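/- Let $d=3$. Write $|\Omega_n\rangle=n^{-1/2}\sum_{j=1}^n|j,j\rangle$, and for a linear map $S:\mathcal M_n\to\mathcal M_n$ let $\rho_S=(\mathrm{id}\otimes S)(|\Omega_n\rangle\langle\Omega_n|)$ be its Jamiolkowski operator. Call $S$ a *mixture of unitaries* if $S(\rho)=\sum_{i=1}^N p_iU_i\rho U_i^\dagger$ for some $N$, unitary $U_i\in\mathcal M_n$ and $p_i>0$ with $\sum_ip_i=1$. Let $\mathbb F|k,l\rangle=|l,k\rangle$ on $\mathbb C^3\otimes\mathbb C^3$, and let $\rho_-=(\mathbb 1-\mathbb F)/6$ and $\rho_+=(\mathbb 1+\mathbb F)/12$ be the normalized projections onto the antisymmetric and the symmetric subspace. For $-\tfrac43\le\epsilon\le\tfrac23=\tfrac2d$ let $$T_\epsilon:\mathcal M_3\to\mathcal M_3,\qquad T_\epsilon(\rho)=\frac{1+\delta}{3}\,\mathrm{tr}[\rho]\,\mathbb 1-\delta\,\rho^T,\qquad \delta=\frac14+\frac{3\epsilon}{8}.$$ For linear maps $S$ on $\mathcal M_9=\mathcal M_3\otimes\mathcal M_3$ put $$\big(\langle F\rangle,\langle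 F_{12}\rangle\big)_S=\big(\mathrm{tr}[\rho_SF],\mathrm{tr}[\rho_SF_{12}]\big),\qquad F=\tfrac12(\mathbb F^{(1)}+\mathbb F^{(2)}),\quad F_{12}=\mathbb F^{(1)}\mathbb F^{(2)},$$ where $\mathbb F^{(k)}$ exchanges the $k$-th tensor factor $\mathbb C^3$ of the input with the $k$-th tensor factor of the output. Finally let $$\epsilon^*=\tfrac23\big(4-3\sqrt2-\sqrt3+\sqrt6\big).$$ Then: 1. For all $\epsilon\in[-\frac43,\frac23]$ the map $T_\epsilon$ is a unital quantum channel (completely positive, trace preserving, $T_\epsilon(\mathbb 1)=\mathbb 1$), $\rho_{T_\epsilon}=(1-\frac13+\frac\epsilon2)\rho_-+(\frac13-\frac\epsilon2)\rho_+$ and $\mathrm{tr}[\rho_{T_\epsilon}\mathbb F]=-1+\frac23-\epsilon$. 2. For all $\epsilon\in(0,\frac23]$ the channel $T_\epsilon$ is not a mixture of unitaries. 3. For $\vartheta\in[0,\pi/2]$ let $D(\vartheta)=R\oplus R\oplus R\oplus R\oplus 1$ with $R=\begin{pmatrix}\cos\vartheta&-\sin\vartheta\\\sin\vartheta&\cos\vartheta\end{pmatrix}$,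 let $$V=\begin{pmatrix} 0&\frac{i}{\sqrt2}&-\frac{i}{2\sqrt6}&0&-\frac{i}{2\sqrt2}&0&0&0&\frac1{\sqrt3}\\ \frac{i}{\sqrt2}&0&-\sqrt{\frac38}&0&\frac1{2\sqrt2}&0&0&0&0\\ 0&0&0&0&0&\frac1{\sqrt2}&0&\frac{i}{\sqrt2}&0\\ \frac{i}{\sqrt2}&0&\sqrt{\frac38}&0&-\frac1{2\sqrt2}&0&0&0&0\\ 0&0&\frac{i}{\sqrt6}&0&\frac{i}{\sqrt2}&0&0&0&\frac1{\sqrt3}\\ 0&0&0&\frac1{\sqrt2}&0&0&\frac{i}{\sqrt2}&0&0\\ 0&0&0&0&0&-\frac1{\sqrt2}&0&\frac{i}{\sqrt2}&0\\ 0&0&0&-\frac1{\sqrt2}&0&0&\frac{i}{\sqrt2}&0&0\\ 0&-\frac{i}{\sqrt2}&-\frac{i}{2\sqrt6}&0&-\frac{i}{2\sqrt2}&0&0&0&\frac1{\sqrt3} \end{pmatrix}$$ with respect to the basis $|11\rangle,|12\rangle,\dots,|33\rangle$, and let $U(\vartheta)=VD(\vartheta)V^T$. Then $U(\vartheta)$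 is unitary, and the channel $\rho\mapsto U(\vartheta)\rho\,U(\vartheta)^\dagger$ on $\mathcal M_9$ has the coordinates $$\big(\langle F\rangle,\langle F_{12}\rangle\big)=\tfrac19\Big(-\tfrac83(\cos\vartheta+1)^2+3,\;16\cos^2\vartheta-7\Big).$$ 4. For all $\epsilon\in[-\frac43,\frac23]$ the map $T_\epsilon\otimes T_\epsilon$ has the coordinates $(x,x^2)$ with $x=-1+\frac23-\epsilon$. For $\epsilon=\epsilon^*$ they coincide with the coordinates in 3 for some $\vartheta\in[0,\pi/2]$. 5. For all $\epsilon\in[-\frac43,\epsilon^*]$ the channel $T_\epsilon\otimes T_\epsilon$ is a mixture of unitaries. Here $\epsilon^*\approx1/\sqrt{10}$, in the sense that $|\epsilon^*-1/\sqrt{10}|<10^{-3}$. In particular, for $0<\epsilon\le\epsilon^*$ the channel $T_\epsilon$ is not a mixture of unitaries while $T_\epsilon\otimes T_\epsilon$ is one. -/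

import Mathlib

open scoped Kronecker ComplexOrder

noncomputable section

namespace TwoCopies

/-! ### Channels on matrix algebras -/

section Channels

variable {m n : Type*} [Fintype m] [DecidableEq m] [Fintype n] [DecidableEq n]

/-- The tensor product `S ⊗ T` of two linear maps on matrix algebras, acting on matrices indexed by
pairs; it is characterised by `tensorMap_kronecker`. -/
def tensorMap (S : Matrix m m ℂ →ₗ[ℂ] Matrix m m ℂ) (T : Matrix n n ℂ →ₗ[ℂ] Matrix n n ℂ) :
    Matrix (m × n) (m × n) ℂ →ₗ[ℂ] Matrix (m × n) (m × n) ℂ :=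
  (kroneckerLinearEquiv m m n n ℂ).toLinearMap ∘ₗ
    TensorProduct.map S T ∘ₗ (kroneckerLinearEquiv m m n n ℂ).symm.toLinearMap

theorem tensorMap_kronecker (S : Matrix m m ℂ →ₗ[ℂ] Matrix m m ℂ)
    (T : Matrix n n ℂ →ₗ[ℂ] Matrix n n ℂ) (A : Matrix m m ℂ) (B : Matrix n n ℂ) :
    tensorMap S T (A ⊗ₖ B) = S A ⊗ₖ T B := by
  simp [tensorMap]

/-- Complete positivity: `id_k ⊗ T` preserves positive semidefiniteness for every `k`. -/
def IsCompletelyPositive (T : Matrix n n ℂ →ₗ[ℂ] Matrix n n ℂ) : Prop :=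
  ∀ (k : ℕ) (X : Matrix (Fin k × n) (Fin k × n) ℂ), X.PosSemidef →
    (tensorMap (LinearMap.id : Matrix (Fin k) (Fin k) ℂ →ₗ[ℂ] _) T X).PosSemidef

/-- A unital (doubly stochastic) quantum channel. -/
structure IsUnitalChannel (T : Matrix n n ℂ →ₗ[ℂ] Matrix n n ℂ) : Prop where
  completelyPositive : IsCompletelyPositive T
  tracePreserving : ∀ ρ, (T ρ).trace = ρ.trace
  unital : T 1 = 1

/-- The conjugation `ρ ↦ U ρ U†`. -/
def conjBy (U : Matrix n n ℂ) : Matrix n n ℂ →ₗ[ℂ] Matrix n n ℂ :=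
  LinearMap.mulRight ℂ U.conjTranspose ∘ₗ LinearMap.mulLeft ℂ U

theorem conjBy_apply (U ρ : Matrix n n ℂ) : conjBy U ρ = U * ρ * U.conjTranspose := rfl

/-- `T` is a mixture of unitary channels: `T(ρ) = ∑ i, pᵢ Uᵢ ρ Uᵢ†` is a finite convex
combination of conjugations by unitary matrices. -/
def IsMixtureOfUnitaries (T : Matrix n n ℂ →ₗ[ℂ] Matrix n n ℂ) : Prop :=
  ∃ (N : ℕ) (p : Fin N → ℝ) (U : Fin N → Matrix n n ℂ),
    (∀ i, 0 < p i) ∧ ∑ i, p i = 1 ∧ (∀ i, U i ∈ Matrix.unitaryGroup n ℂ) ∧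
      T = ∑ i, (p i : ℂ) • conjBy (U i)

/-- The maximally entangled unit vector `Ω = d^{-1/2} ∑ j, |j, j⟩`, where `d` is the
cardinality of the index type. -/
def maxEntangled (n : Type*) [Fintype n] [DecidableEq n] : n × n → ℂ :=
  fun x => if x.1 = x.2 then ((1 / √(Fintype.card n : ℝ) : ℝ) : ℂ) else 0

/-- The Jamiolkowski operator `(id ⊗ T)(|Ω⟩⟨Ω|)`. -/
def jamiolkowski (T : Matrix n n ℂ →ₗ[ℂ] Matrix n n ℂ) : Matrix (n × n) (n × n) ℂ :=
  tensorMap LinearMap.id T (Matrix.vecMulVec (maxEntangled n) (star (maxEntangled n)))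

end Channels

/-! ### Flip operators and coordinates -/

section Flips

variable (n : Type*) [Fintype n] [DecidableEq n]

/-- The flip operator `|k, l⟩ ↦ |l, k⟩`. -/
def flipOp : Matrix (n × n) (n × n) ℂ := Equiv.Perm.permMatrix ℂ (Equiv.prodComm n n)

/-- For operators on (inputs of both copies) × (outputs of both copies): exchange of the input and
the output of the first copy, `|(a₁, a₂), (b₁, b₂)⟩ ↦ |(b₁, a₂), (a₁, b₂)⟩`. -/
def swapFirst : Equiv.Perm ((n × n) × (n × n)) where
  toFun x := ((x.2.1, x.1.2), (x.1.1, x.2.2))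
  invFun x := ((x.2.1, x.1.2), (x.1.1, x.2.2))
  left_inv _ := rfl
  right_inv _ := rfl

/-- Exchange of the input and the output of the second copy,
`|(a₁, a₂), (b₁, b₂)⟩ ↦ |(a₁, b₂), (b₁, a₂)⟩`. -/
def swapSecond : Equiv.Perm ((n × n) × (n × n)) where
  toFun x := ((x.1.1, x.2.2), (x.2.1, x.1.2))
  invFun x := ((x.1.1, x.2.2), (x.2.1, x.1.2))
  left_inv _ := rfl
  right_inv _ := rfl

/-- The average of the flip of the first copy and the flip of the second copy. -/
def opF : Matrix ((n × n) × (n × n)) ((n × n) × (n × n)) ℂ :=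
  (1 / 2 : ℂ) • ((swapFirst n).permMatrix ℂ + (swapSecond n).permMatrix ℂ)

/-- The tensor product of the flips of both copies. -/
def opF12 : Matrix ((n × n) × (n × n)) ((n × n) × (n × n)) ℂ :=
  (swapFirst n).permMatrix ℂ * (swapSecond n).permMatrix ℂ

variable {n}

/-- The coordinates of a linear map `S` on the matrices of a bipartite system: the expectation
values of `opF` and `opF12` in the Jamiolkowski operator of `S`. -/
def coords (S : Matrix (n × n) (n × n) ℂ →ₗ[ℂ] Matrix (n × n) (n × n) ℂ) : ℂ × ℂ :=
  ((jamiolkowski S * opF n).trace, (jamiolkowski S * opF12 n).trace)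

end Flips

/-- The normalized projection `(1 - flip) / (d (d - 1))` onto the antisymmetric subspace. -/
def rhoMinus (d : ℕ) : Matrix (Fin d × Fin d) (Fin d × Fin d) ℂ :=
  (1 / ((d : ℂ) * ((d : ℂ) - 1))) • (1 - flipOp (Fin d))

/-- The normalized projection `(1 + flip) / (d (d + 1))` onto the symmetric subspace. -/
def rhoPlus (d : ℕ) : Matrix (Fin d × Fin d) (Fin d × Fin d) ℂ :=
  (1 / ((d : ℂ) * ((d : ℂ) + 1))) • (1 + flipOp (Fin d))

/-! ### The family of channels -/

/-- `ρ ↦ (1 + δ) tr[ρ] 1 / d - δ ρᵀ`. -/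
def channelT (d : ℕ) (δ : ℝ) :
    Matrix (Fin d) (Fin d) ℂ →ₗ[ℂ] Matrix (Fin d) (Fin d) ℂ :=
  ((1 + (δ : ℂ)) / (d : ℂ)) • (Matrix.traceLinearMap (Fin d) ℂ ℂ).smulRight 1
    - (δ : ℂ) • (Matrix.transposeLinearEquiv (Fin d) (Fin d) ℂ ℂ).toLinearMap

theorem channelT_apply (d : ℕ) (δ : ℝ) (ρ : Matrix (Fin d) (Fin d) ℂ) :
    channelT d δ ρ =
      ((1 + (δ : ℂ)) / (d : ℂ) * ρ.trace) • (1 : Matrix (Fin d) (Fin d) ℂ)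
        - (δ : ℂ) • ρ.transpose := by
  simp [channelT, smul_smul]

/-- The value of `δ` that belongs to the parameter `ε`. -/
def deltaOf (d : ℕ) (ε : ℝ) : ℝ := 1 / ((d : ℝ) + 1) + (d : ℝ) * ε / ((d : ℝ) ^ 2 - 1)

/-- The threshold for two copies in dimension three. -/
def epsStar : ℝ := 2 / 3 * (4 - 3 * √2 - √3 + √6)

/-! ### The explicit family of unitary `9 × 9` matrices -/

/-- Rows are ordered lexicographically: `(0,0), (0,1), (0,2), (1,0), …, (2,2)`. -/
def matV : Matrix (Fin 3 × Fin 3) (Fin 9) ℂ :=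
  let i := Complex.I
  let a : ℂ := ((1 / √2 : ℝ) : ℂ)
  let b : ℂ := ((1 / (2 * √6) : ℝ) : ℂ)
  let c : ℂ := ((1 / (2 * √2) : ℝ) : ℂ)
  let e : ℂ := ((1 / √3 : ℝ) : ℂ)
  let f : ℂ := ((√(3 / 8) : ℝ) : ℂ)
  let g : ℂ := ((1 / √6 : ℝ) : ℂ)
  Matrix.submatrix
    !![    0,  i * a, -i * b,  0, -i * c,  0,     0,     0, e;
       i * a,      0,     -f,  0,      c,  0,     0,     0, 0;
           0,      0,      0,  0,      0,  a,     0, i * a, 0;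
       i * a,      0,      f,  0,     -c,  0,     0,     0, 0;
           0,      0,  i * g,  0,  i * a,  0,     0,     0, e;
           0,      0,      0,  a,      0,  0, i * a,     0, 0;
           0,      0,      0,  0,      0, -a,     0, i * a, 0;
           0,      0,      0, -a,      0,  0, i * a,     0, 0;
           0, -i * a, -i * b,  0, -i * c,  0,     0,     0, e]
    (finProdFinEquiv : Fin 3 × Fin 3 ≃ Fin 9) id

/-- Four rotation blocks `[[cos θ, -sin θ], [sin θ, cos θ]]` followed by a single `1`. -/
def matD (θ : ℝ) : Matrix (Fin 9) (Fin 9) ℂ :=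
  let c : ℂ := ((Real.cos θ : ℝ) : ℂ)
  let s : ℂ := ((Real.sin θ : ℝ) : ℂ)
  !![c, -s, 0,  0, 0,  0, 0,  0, 0;
     s,  c, 0,  0, 0,  0, 0,  0, 0;
     0,  0, c, -s, 0,  0, 0,  0, 0;
     0,  0, s,  c, 0,  0, 0,  0, 0;
     0,  0, 0,  0, c, -s, 0,  0, 0;
     0,  0, 0,  0, s,  c, 0,  0, 0;
     0,  0, 0,  0, 0,  0, c, -s, 0;
     0,  0, 0,  0, 0,  0, s,  c, 0;
     0,  0, 0,  0, 0,  0, 0,  0, 1]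

/-- The family `U(θ) = V D(θ) Vᵀ`. -/
def matU (θ : ℝ) : Matrix (Fin 3 × Fin 3) (Fin 3 × Fin 3) ℂ :=
  matV * matD θ * matV.transpose

end TwoCopies

end

/-!
A single copy fails because `U - Uᵀ` is skew of odd size, hence singular: this forces
`tr[Uᴴ Uᵀ] ≥ 2 - d` for every unitary `U`, a lower bound on the flip expectation of every mixture
of unitary channels that `T_ε` violates as soon as `ε > 0`.

For two copies, conjugating a Choi matrix with `(A ⊗ B) ⊗ (A ⊗ B)`, for unitary `A` and `B`, and
with the exchange of the two copies preserves both coordinates and the property of coming from a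
mixture of unitary channels. A mixture fixed by all these symmetries exists by compactness and
convexity; its Choi matrix is in the commutant, which is spanned by `1`, `F` and `F₁₂`, and there
the coordinates and the trace determine it. So `T_ε ⊗ T_ε` is a mixture as soon as some mixture has
the coordinates `(x, x ^ 2)` of `T_ε ⊗ T_ε`. The coordinates of mixtures form a convex set; it
contains the points of the parabola given by product rotations, the curve of the `U(θ)`, and in
particular the point where this curve crosses the parabola, which is the one of `ε*`. Between that
point and `(1, 1)` the parabola runs above the curve and below the chord.
-/

open Matrix

namespace TwoCopies

section Convexity

theorem isCompact_convexHull {E : Type*} [AddCommGroup E] [Module ℝ E]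
    [TopologicalSpace E] [ContinuousAdd E] [ContinuousSMul ℝ E] [FiniteDimensional ℝ E]
    {s : Set E} (hs : IsCompact s) : IsCompact (convexHull ℝ s) := by
  rcases s.eq_empty_or_nonempty with rfl | ⟨z₀, hz₀⟩
  · simp
  let N := Module.finrank ℝ E + 1
  let combine : (Fin N → ℝ) × (Fin N → E) → E := fun q => ∑ i, q.1 i • q.2 i
  suffices convexHull ℝ s =
      combine '' (stdSimplex ℝ (Fin N) ×ˢ Set.univ.pi fun _ : Fin N => s) by
    rw [this]
    exact ((isCompact_stdSimplex ℝ (Fin N)).prod (isCompact_univ_pi fun _ => hs)).image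
      (by fun_prop)
  refine Set.Subset.antisymm (fun x hx => ?_) ?_
  -- Carathéodory's points are affinely independent, hence at most `N`; pad with zero weights.
  · obtain ⟨ι, _, z, w, hz, hind, hw, hsum, rfl⟩ := eq_pos_convex_span_of_mem_convexHull hx
    have hcard : Fintype.card ι ≤ N :=
      hind.card_le_finrank_succ.trans (Nat.succ_le_succ (Submodule.finrank_le _))
    let f : ι ↪ Fin N := (Fintype.equivFin ι).toEmbedding.trans (Fin.castLEEmb hcard)
    have hweight (k : Fin N) (hk : k ∉ Set.range f) : Function.extend f w 0 k = 0 :=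
      Function.extend_apply' _ _ k hk
    refine ⟨(Function.extend f w 0, Function.extend f z fun _ => z₀),
      ⟨⟨fun k => ?_, ?_⟩, fun k _ => ?_⟩, (Fintype.sum_of_injective f f.injective _ _
        (fun k hk => ?_) fun i => ?_).symm⟩
    · by_cases hk : k ∈ Set.range f
      · obtain ⟨i, rfl⟩ := hk
        exact (hw i).le.trans_eq (f.injective.extend_apply w 0 i).symm
      · exact (hweight k hk).ge
    · rw [← hsum]
      exact (Fintype.sum_of_injective f f.injective _ _ hweight fun i =>
        (f.injective.extend_apply w 0 i).symm).symm
    · by_cases hk : k ∈ Set.range f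
      · obtain ⟨i, rfl⟩ := hk
        simpa only [f.injective.extend_apply] using hz ⟨i, rfl⟩
      · simpa only [Function.extend_apply' z (fun _ => z₀) k hk] using hz₀
    · simp only [hweight k hk, zero_smul]
    · simp only [f.injective.extend_apply]
  · rintro _ ⟨⟨w, z⟩, ⟨hw, hz⟩, rfl⟩
    exact (convex_convexHull ℝ s).sum_mem (fun i _ => hw.1 i) hw.2
      fun i _ => subset_convexHull ℝ s (hz i trivial)

variable {m : Type*} [Fintype m]

theorem trace_conjTranspose_mul_self_parallelogram (A B : Matrix m m ℂ) :
    ((A + B)ᴴ * (A + B)).trace + ((A - B)ᴴ * (A - B)).trace =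
      2 * ((Aᴴ * A).trace + (Bᴴ * B).trace) := by
  simp only [conjTranspose_add, conjTranspose_sub, add_mul, sub_mul, mul_add, mul_sub,
    trace_add, trace_sub]
  ring

/-- The element of least Frobenius norm of a compact convex set is unique, hence fixed by every
conjugation that preserves the set. -/
theorem exists_mem_forall_unitary_conj_eq_self [DecidableEq m] {K : Set (Matrix m m ℂ)}
    (hK : IsCompact K) (hconv : Convex ℝ K) (hne : K.Nonempty) :
    ∃ Z ∈ K, ∀ R ∈ unitaryGroup m ℂ, (∀ X ∈ K, R * X * Rᴴ ∈ K) → R * Z * Rᴴ = Z := by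
  let q (X : Matrix m m ℂ) : ℝ := (Xᴴ * X).trace.re
  obtain ⟨Z, hZ, hmin⟩ := hK.exists_isMinOn hne (f := q)
    (by unfold q; fun_prop)
  refine ⟨Z, hZ, fun R hR hinv => ?_⟩
  set Y := R * Z * Rᴴ
  have hY : q Y = q Z := by
    have hR' : Rᴴ * R = 1 := mem_unitaryGroup_iff'.mp hR
    calc q Y = (R * (Zᴴ * (Rᴴ * R) * Z) * Rᴴ).trace.re := by
          simp only [q, Y, conjTranspose_mul, conjTranspose_conjTranspose, Matrix.mul_assoc]
      _ = q Z := by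
          rw [hR', Matrix.mul_one, trace_mul_comm, ← Matrix.mul_assoc, hR', Matrix.one_mul]
  have hmid : q Z ≤ q ((1 / 2 : ℝ) • (Y + Z)) := by
    refine hmin ?_
    rw [smul_add]
    exact hconv (hinv Z hZ) hZ (by norm_num) (by norm_num) (by norm_num)
  have hscale : q ((1 / 2 : ℝ) • (Y + Z)) = q (Y + Z) / 4 := by
    simp only [q, conjTranspose_smul, Matrix.smul_mul, Matrix.mul_smul, trace_smul, Complex.smul_re]
    simp
    ring
  have hparallel : q (Y + Z) + q (Y - Z) = 2 * (q Y + q Z) := by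
    simpa [q] using congrArg Complex.re (trace_conjTranspose_mul_self_parallelogram Y Z)
  have hdiff : q (Y - Z) = 0 := by
    have hnonneg : 0 ≤ q (Y - Z) :=
      (Complex.le_def.mp (posSemidef_conjTranspose_mul_self (Y - Z)).trace_nonneg).1
    linarith
  refine sub_eq_zero.mp (trace_conjTranspose_mul_self_eq_zero_iff.mp (Complex.ext hdiff ?_))
  exact (Complex.le_def.mp (posSemidef_conjTranspose_mul_self (Y - Z)).trace_nonneg).2.symm

theorem isCompact_unitaryGroup [DecidableEq m] :
    IsCompact (unitaryGroup m ℂ : Set (Matrix m m ℂ)) := by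
  refine (isCompact_univ_pi fun _ => isCompact_univ_pi fun _ =>
    isCompact_closedBall (0 : ℂ) 1).of_isClosed_subset ?_ fun U hU i _ j _ =>
      mem_closedBall_zero_iff.mpr (entry_norm_bound_of_unitary hU i j)
  have : (unitaryGroup m ℂ : Set (Matrix m m ℂ)) = {U | U * Uᴴ = 1} :=
    Set.ext fun _ => mem_unitaryGroup_iff
  rw [this]
  exact isClosed_eq (by fun_prop) continuous_const

end Convexity

section Choi

variable {m n : Type*} [DecidableEq m] [DecidableEq n]

/-- The Choi matrix of a linear map `S` on matrices, with rows and columns indexed by pairs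
(input, output). It is `card n` times the Jamiolkowski operator. -/
def choi : (Matrix n n ℂ →ₗ[ℂ] Matrix n n ℂ) →ₗ[ℂ] Matrix (n × n) (n × n) ℂ where
  toFun S := Matrix.of fun x y => S (Matrix.single x.1 y.1 1) x.2 y.2
  map_add' _ _ := rfl
  map_smul' _ _ := rfl

theorem choi_apply (S : Matrix n n ℂ →ₗ[ℂ] Matrix n n ℂ) (x y : n × n) :
    choi S x y = S (Matrix.single x.1 y.1 1) x.2 y.2 := rfl

theorem choi_injective [Finite n] :
    Function.Injective (choi : (Matrix n n ℂ →ₗ[ℂ] Matrix n n ℂ) → _) := fun _ _ h =>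
  Matrix.ext_linearMap ℂ fun a a' => LinearMap.ext_ring <|
    Matrix.ext fun b b' => congrFun (congrFun h (a, b)) (a', b')

variable [Fintype m] [Fintype n]

theorem choi_conjBy (U : Matrix n n ℂ) :
    choi (conjBy U) = vecMulVec (vec U) (star (vec U)) := by
  ext x y
  simp [choi_apply, conjBy_apply, vecMulVec_apply, vec, Matrix.mul_apply, Matrix.single_apply,
    ite_and]

theorem trace_choi (S : Matrix n n ℂ →ₗ[ℂ] Matrix n n ℂ) : (choi S).trace = (S 1).trace := by
  rw [← Matrix.sum_single_one, map_sum, trace_sum]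
  exact Fintype.sum_prod_type _

theorem tensorMap_single (S : Matrix m m ℂ →ₗ[ℂ] Matrix m m ℂ)
    (T : Matrix n n ℂ →ₗ[ℂ] Matrix n n ℂ) (x y : m × n) :
    tensorMap S T (Matrix.single x y 1) =
      S (Matrix.single x.1 y.1 1) ⊗ₖ T (Matrix.single x.2 y.2 1) := by
  rw [← tensorMap_kronecker, Matrix.single_kronecker_single, mul_one]

theorem choi_tensorMap (S : Matrix m m ℂ →ₗ[ℂ] Matrix m m ℂ) (T : Matrix n n ℂ →ₗ[ℂ] Matrix n n ℂ) :
    choi (tensorMap S T) = (choi S ⊗ₖ choi T).submatrix (Equiv.prodProdProdComm m n m n)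
      (Equiv.prodProdProdComm m n m n) := by
  ext x y
  rw [choi_apply, tensorMap_single]
  rfl

theorem tensorMap_id_apply (T : Matrix n n ℂ →ₗ[ℂ] Matrix n n ℂ) (X : Matrix (m × n) (m × n) ℂ)
    (x y : m × n) :
    tensorMap LinearMap.id T X x y =
      ∑ i, ∑ j, X (x.1, i) (y.1, j) * choi T (i, x.2) (j, y.2) := by
  induction X using Matrix.induction_on' with
  | h_zero => simp
  | h_add p q hp hq =>
    simp only [map_add, Matrix.add_apply, hp, hq, add_mul, Finset.sum_add_distrib]
  | h_std_basis a b c =>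
    have : Matrix.single a b c = c • Matrix.single a b 1 := by simp
    rw [this, map_smul, tensorMap_single]
    simp [choi_apply, Matrix.single_apply, Prod.ext_iff, ite_and]

theorem tensorMap_id_vecMulVec (T : Matrix n n ℂ →ₗ[ℂ] Matrix n n ℂ) (A : Matrix m n ℂ) :
    tensorMap LinearMap.id T (vecMulVec (fun x => A x.1 x.2) (star fun x => A x.1 x.2)) =
      (A ⊗ₖ (1 : Matrix n n ℂ)) * choi T * (A ⊗ₖ (1 : Matrix n n ℂ))ᴴ := by
  ext x y
  simp only [tensorMap_id_apply, Matrix.mul_apply, Fintype.sum_prod_type, kroneckerMap_apply,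
    Matrix.one_apply, mul_ite, mul_one, mul_zero, ite_mul, zero_mul, Finset.sum_ite_eq,
    Finset.mem_univ, if_true, conjTranspose_apply, apply_ite star, star_zero, vecMulVec_apply,
    Pi.star_apply, Finset.sum_mul]
  rw [Finset.sum_comm]
  exact Finset.sum_congr rfl fun j _ => Finset.sum_congr rfl fun i _ => mul_right_comm _ _ _

theorem jamiolkowski_eq_smul_choi (S : Matrix n n ℂ →ₗ[ℂ] Matrix n n ℂ) :
    jamiolkowski S = (1 / (Fintype.card n : ℂ)) • choi S := by
  let r : ℝ := 1 / √(Fintype.card n)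
  have hr : (r : ℂ) * r = 1 / (Fintype.card n : ℂ) := by
    rw [← Complex.ofReal_mul, ← sq, div_pow, Real.sq_sqrt (Nat.cast_nonneg _)]
    push_cast
    ring
  have hvec : maxEntangled n = fun x => ((r : ℂ) • (1 : Matrix n n ℂ)) x.1 x.2 := by
    ext x
    simp [maxEntangled, Matrix.one_apply, r]
  rw [jamiolkowski, hvec, tensorMap_id_vecMulVec, ← hr]
  simp only [smul_kronecker, one_kronecker_one, conjTranspose_smul, conjTranspose_one,
    Matrix.smul_mul, Matrix.mul_smul, Matrix.one_mul, Matrix.mul_one, smul_smul,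
    Complex.star_def, Complex.conj_ofReal]

theorem isCompletelyPositive_of_posSemidef_choi {T : Matrix n n ℂ →ₗ[ℂ] Matrix n n ℂ}
    (hT : (choi T).PosSemidef) : IsCompletelyPositive T := by
  intro k X hX
  obtain ⟨N, v, rfl⟩ := posSemidef_iff_eq_sum_vecMulVec.mp hX
  rw [map_sum]
  refine posSemidef_sum _ fun i _ => ?_
  exact tensorMap_id_vecMulVec T (Matrix.of (Function.curry (v i))) ▸
    hT.mul_mul_conjTranspose_same _

end Choi

section Mixtures

variable {n : Type*} [Fintype n] [DecidableEq n]

/-- The set of unitary channels. -/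
def unitaryChannels (n : Type*) [Fintype n] [DecidableEq n] :
    Set (Matrix n n ℂ →ₗ[ℂ] Matrix n n ℂ) :=
  conjBy '' unitaryGroup n ℂ

theorem isMixtureOfUnitaries_iff_mem_convexHull {S : Matrix n n ℂ →ₗ[ℂ] Matrix n n ℂ} :
    IsMixtureOfUnitaries S ↔ S ∈ convexHull ℝ (unitaryChannels n) := by
  constructor
  · rintro ⟨N, p, U, hp, hsum, hU, rfl⟩
    exact (convex_convexHull ℝ _).sum_mem (fun i _ => (hp i).le) hsum fun i _ =>
      subset_convexHull ℝ _ ⟨U i, hU i, rfl⟩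
  · intro h
    obtain ⟨ι, _, z, w, hz, -, hw, hsum, rfl⟩ := eq_pos_convex_span_of_mem_convexHull h
    choose U hU hUz using fun i => hz ⟨i, rfl⟩
    let e := (Fintype.equivFin ι).symm
    refine ⟨Fintype.card ι, w ∘ e, U ∘ e, fun k => hw (e k), (e.sum_comp w).trans hsum,
      fun k => hU (e k), ?_⟩
    rw [← e.sum_comp]
    simp only [Function.comp_apply, hUz]
    rfl

end Mixtures

section Flip

variable {n : Type*} [DecidableEq n]

theorem flipOp_apply (x y : n × n) : flipOp n x y = if x.swap = y then 1 else 0 := by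
  simp [flipOp, Equiv.Perm.permMatrix, PEquiv.toMatrix_apply, eq_comm]

theorem transpose_flipOp : (flipOp n)ᵀ = flipOp n := transpose_permMatrix _

theorem conjTranspose_flipOp : (flipOp n)ᴴ = flipOp n := conjTranspose_permMatrix _

variable [Fintype n]

theorem flipOp_mulVec_vec (U : Matrix n n ℂ) : flipOp n *ᵥ vec U = vec Uᵀ :=
  permMatrix_mulVec _

theorem flipOp_mul_flipOp : flipOp n * flipOp n = 1 := by
  rw [flipOp, ← permMatrix_mul, ← permMatrix_one]
  rfl

theorem flipOp_mem_unitaryGroup : flipOp n ∈ unitaryGroup (n × n) ℂ := by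
  rw [mem_unitaryGroup_iff, star_eq_conjTranspose, conjTranspose_flipOp, flipOp_mul_flipOp]

theorem flipOp_mul_apply {m : Type*} (X : Matrix (n × n) m ℂ) (x : n × n) (y : m) :
    (flipOp n * X) x y = X x.swap y := by
  rw [flipOp, PEquiv.toMatrix_toPEquiv_mul]
  rfl

theorem mul_flipOp_apply {m : Type*} (X : Matrix m (n × n) ℂ) (x : m) (y : n × n) :
    (X * flipOp n) x y = X x y.swap := by
  rw [flipOp, PEquiv.mul_toMatrix_toPEquiv]
  rfl

theorem trace_flipOp : (flipOp n).trace = Fintype.card n := by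
  simp [trace, flipOp_apply, Fintype.sum_prod_type, Prod.ext_iff, ite_and]

theorem flipOp_mul_kronecker (A B : Matrix n n ℂ) :
    flipOp n * (A ⊗ₖ B) = (B ⊗ₖ A) * flipOp n := by
  ext x y
  simp only [flipOp_mul_apply, mul_flipOp_apply, kroneckerMap_apply, Prod.fst_swap, Prod.snd_swap,
    mul_comm]

/-- The expectation value `tr[ρ_S 𝔽]` of the flip operator in the Jamiolkowski operator of `S`, the
coordinate of a linear map on a single system. -/
noncomputable def flipExpectation (S : Matrix n n ℂ →ₗ[ℂ] Matrix n n ℂ) : ℂ :=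
  (jamiolkowski S * flipOp n).trace

theorem flipExpectation_eq (S : Matrix n n ℂ →ₗ[ℂ] Matrix n n ℂ) :
    flipExpectation S = 1 / (Fintype.card n : ℂ) * (choi S * flipOp n).trace := by
  rw [flipExpectation, jamiolkowski_eq_smul_choi, Matrix.smul_mul, trace_smul, smul_eq_mul]

theorem trace_vecMulVec_vec_mul_flipOp (U : Matrix n n ℂ) :
    (vecMulVec (vec U) (star (vec U)) * flipOp n).trace = (Uᴴ * Uᵀ).trace := by
  rw [trace_mul_comm, mul_vecMulVec, trace_vecMulVec, flipOp_mulVec_vec, dotProduct_comm,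
    star_vec_dotProduct_vec]

theorem flipExpectation_conjBy (U : Matrix n n ℂ) :
    flipExpectation (conjBy U) = 1 / (Fintype.card n : ℂ) * (Uᴴ * Uᵀ).trace := by
  rw [flipExpectation_eq, choi_conjBy, trace_vecMulVec_vec_mul_flipOp]

theorem isLinearMap_flipExpectation :
    IsLinearMap ℝ (flipExpectation : (Matrix n n ℂ →ₗ[ℂ] Matrix n n ℂ) → ℂ) where
  map_add S T := by simp only [flipExpectation_eq, map_add, add_mul, trace_add, mul_add]
  map_smul r S := by
    rw [← algebraMap_smul ℂ r S, ← algebraMap_smul ℂ r]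
    simp only [flipExpectation_eq, map_smul, Matrix.smul_mul, trace_smul, smul_eq_mul]
    ring

end Flip

section Positivity

variable {n : Type*} [Finite n] [DecidableEq n]

theorem posSemidef_one_add_flipOp : (1 + flipOp n).PosSemidef := by
  cases nonempty_fintype n
  have h : 1 + flipOp n = (1 / 2 : ℝ) • ((1 + flipOp n) * (1 + flipOp n)ᴴ) := by
    rw [conjTranspose_add, conjTranspose_one, conjTranspose_flipOp, add_mul, mul_add, mul_add,
      flipOp_mul_flipOp, one_mul, one_mul, mul_one]
    module
  rw [h]
  exact (posSemidef_self_mul_conjTranspose _).smul (by norm_num)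

theorem posSemidef_one_sub_flipOp : (1 - flipOp n).PosSemidef := by
  cases nonempty_fintype n
  have h : 1 - flipOp n = (1 / 2 : ℝ) • ((1 - flipOp n) * (1 - flipOp n)ᴴ) := by
    rw [conjTranspose_sub, conjTranspose_one, conjTranspose_flipOp, sub_mul, mul_sub, mul_sub,
      flipOp_mul_flipOp, one_mul, one_mul, mul_one]
    module
  rw [h]
  exact (posSemidef_self_mul_conjTranspose _).smul (by norm_num)

end Positivity

section OddDimension

variable {n : Type*} [Fintype n]

theorem eigenvalue_le_trace_of_posSemidef {A : Matrix n n ℂ} (hA : A.PosSemidef) {μ : ℝ}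
    {v : n → ℂ} (hv : v ≠ 0) (h : A *ᵥ v = (μ : ℂ) • v) : (μ : ℂ) ≤ A.trace := by
  classical
  have hμ : μ ∈ spectrum ℝ A := by
    rw [← spectrum.algebraMap_mem_iff ℂ, ← Matrix.spectrum_toLin']
    exact (Module.End.hasEigenvalue_of_hasEigenvector
      ⟨Module.End.mem_eigenspace_iff.mpr h, hv⟩).mem_spectrum
  obtain ⟨i, rfl⟩ := hA.isHermitian.spectrum_real_eq_range_eigenvalues ▸ hμ
  rw [hA.isHermitian.trace_eq_sum_eigenvalues]
  exact Finset.single_le_sum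
    (f := fun j => (hA.isHermitian.eigenvalues j : ℂ))
    (fun j _ => Complex.zero_le_real.mpr (hA.eigenvalues_nonneg j)) (Finset.mem_univ i)

theorem exists_conjTranspose_mulVec_eq_of_odd_card (hn : Odd (Fintype.card n))
    (U : Matrix n n ℂ) : ∃ v ≠ 0, Uᴴ *ᵥ v = Uᵀᴴ *ᵥ v := by
  classical
  have hdet : (U - Uᵀ)ᴴ.det = 0 := by
    have hskew : (U - Uᵀ).det = -(U - Uᵀ).det := by
      conv_lhs => rw [← det_transpose, transpose_sub, transpose_transpose, ← neg_sub, det_neg,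
        hn.neg_one_pow, neg_one_mul]
    rw [det_conjTranspose, self_eq_neg.mp hskew, star_zero]
  obtain ⟨v, hv, h⟩ := exists_mulVec_eq_zero_iff.mpr hdet
  exact ⟨v, hv, sub_eq_zero.mp (by rwa [conjTranspose_sub, sub_mulVec] at h)⟩

variable [DecidableEq n]

theorem two_sub_card_le_trace_conjTranspose_mul_transpose (hn : Odd (Fintype.card n))
    {U : Matrix n n ℂ} (hU : U ∈ unitaryGroup n ℂ) :
    2 - (Fintype.card n : ℂ) ≤ (Uᴴ * Uᵀ).trace := by
  obtain ⟨v, hv, hUv⟩ := exists_conjTranspose_mulVec_eq_of_odd_card hn U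
  have hU₁ : U * Uᴴ = 1 := mem_unitaryGroup_iff.mp hU
  have hU₂ : Uᵀ * Uᵀᴴ = 1 := mem_unitaryGroup_iff.mp (transpose_mem_unitaryGroup_iff.mpr hU)
  -- On `ker (U - Uᵀ)ᴴ` the operator `(U + Uᵀ)(U + Uᵀ)ᴴ` acts as `4`, so its trace is `≥ 4`.
  have heig : ((U + Uᵀ) * (U + Uᵀ)ᴴ) *ᵥ v = ((4 : ℝ) : ℂ) • v := by
    have h : (U + Uᵀ) *ᵥ (Uᴴ *ᵥ v) = (2 : ℂ) • v := by
      rw [add_mulVec, mulVec_mulVec, hU₁, hUv, mulVec_mulVec, hU₂, one_mulVec, two_smul]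
    rw [conjTranspose_add, ← mulVec_mulVec, add_mulVec Uᴴ, ← hUv, mulVec_add, h]
    push_cast
    module
  have htrace : ((U + Uᵀ) * (U + Uᵀ)ᴴ).trace = 2 * (Fintype.card n + (Uᴴ * Uᵀ).trace) := by
    have hcross : (U * Uᵀᴴ).trace = (Uᴴ * Uᵀ).trace := by
      rw [← trace_transpose, transpose_mul, conjTranspose, transpose_transpose]
      rfl
    rw [conjTranspose_add, add_mul, mul_add, mul_add, hU₁, hU₂, trace_add, trace_add, trace_add,
      trace_one, hcross, trace_mul_comm Uᵀ]
    ring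
  have h := eigenvalue_le_trace_of_posSemidef (posSemidef_self_mul_conjTranspose (U + Uᵀ)) hv heig
  rw [htrace, show ((4 : ℝ) : ℂ) = 2 * 2 by norm_num] at h
  exact sub_le_iff_le_add'.mpr (le_of_mul_le_mul_left h two_pos)

theorem le_flipExpectation_of_odd_card (hn : Odd (Fintype.card n))
    {S : Matrix n n ℂ →ₗ[ℂ] Matrix n n ℂ} (hS : IsMixtureOfUnitaries S) :
    -1 + 2 / (Fintype.card n : ℂ) ≤ flipExpectation S := by
  have hcard : (Fintype.card n : ℂ) ≠ 0 := Nat.cast_ne_zero.mpr hn.pos.ne'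
  have hsub : unitaryChannels n ⊆ flipExpectation ⁻¹' Set.Ici (-1 + 2 / (Fintype.card n : ℂ)) := by
    rintro _ ⟨U, hU, rfl⟩
    rw [Set.mem_preimage, Set.mem_Ici, flipExpectation_conjBy,
      show -1 + 2 / (Fintype.card n : ℂ) = 1 / (Fintype.card n : ℂ) * (2 - Fintype.card n) by
        field_simp; ring]
    exact mul_le_mul_of_nonneg_left (two_sub_card_le_trace_conjTranspose_mul_transpose hn hU)
      (one_div_nonneg.mpr (Nat.cast_nonneg _))
  have hconvex := (convex_Ici (𝕜 := ℝ) (-1 + 2 / (Fintype.card n : ℂ))).is_linear_preimage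
    (isLinearMap_flipExpectation (n := n))
  exact convexHull_min hsub hconvex (isMixtureOfUnitaries_iff_mem_convexHull.mp hS)

end OddDimension

section ChannelT

variable {d : ℕ}

theorem choi_channelT (δ : ℝ) :
    choi (channelT d δ) = ((1 + δ) / d : ℂ) • 1 - (δ : ℂ) • flipOp (Fin d) := by
  ext x y
  rw [choi_apply, channelT_apply, transpose_single]
  by_cases h : x.1 = y.1 <;>
    simp [flipOp_apply, Matrix.single_apply, Matrix.one_apply, Prod.ext_iff, ite_and, h,
      eq_comm (a := x.2)]

theorem channelT_one (hd : d ≠ 0) (δ : ℝ) : channelT d δ 1 = 1 := by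
  have hd₀ : (d : ℂ) ≠ 0 := Nat.cast_ne_zero.mpr hd
  rw [channelT_apply, trace_one, Fintype.card_fin, transpose_one]
  match_scalars
  field_simp
  ring

theorem isUnitalChannel_channelT (hd : d ≠ 0) {δ : ℝ} (hδ₁ : -1 ≤ (d + 1) * δ)
    (hδ₂ : (d - 1) * δ ≤ 1) : IsUnitalChannel (channelT d δ) where
  completelyPositive := by
    have hd₀ : (d : ℂ) ≠ 0 := Nat.cast_ne_zero.mpr hd
    have hchoi : choi (channelT d δ) =
        ((1 - (d - 1) * δ) / (2 * d)) • (1 + flipOp (Fin d)) +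
          ((1 + (d + 1) * δ) / (2 * d)) • (1 - flipOp (Fin d)) := by
      rw [choi_channelT]
      match_scalars <;> simp only [Complex.coe_algebraMap] <;> field_simp <;> ring
    have hd₁ : (0 : ℝ) ≤ 2 * d := by positivity
    refine isCompletelyPositive_of_posSemidef_choi (hchoi ▸ ?_)
    exact (posSemidef_one_add_flipOp.smul (div_nonneg (by linarith) hd₁)).add
      (posSemidef_one_sub_flipOp.smul (div_nonneg (by linarith) hd₁))
  tracePreserving ρ := by
    have hd₀ : (d : ℂ) ≠ 0 := Nat.cast_ne_zero.mpr hd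
    rw [channelT_apply, trace_sub, trace_smul, trace_smul, trace_one, trace_transpose,
      Fintype.card_fin, smul_eq_mul, smul_eq_mul]
    field_simp
    ring
  unital := channelT_one hd δ

theorem isUnitalChannel_channelT_deltaOf (hd : 1 < d) {ε : ℝ} (hε₁ : -(2 * (d - 1) / d) ≤ ε)
    (hε₂ : ε ≤ 2 / d) : IsUnitalChannel (channelT d (deltaOf d ε)) := by
  have hd₀ : (0 : ℝ) < d := Nat.cast_pos.mpr (by lia)
  have hd₁ : (0 : ℝ) < d - 1 := sub_pos.mpr (Nat.one_lt_cast.mpr hd)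
  have hd₂ : (d : ℝ) ^ 2 - 1 = (d - 1) * (d + 1) := by ring
  apply isUnitalChannel_channelT (by lia)
  · have h : (d + 1) * deltaOf d ε = 1 + d * ε / (d - 1) := by
      rw [deltaOf, hd₂]
      field_simp
    rw [← neg_div, div_le_iff₀' hd₀] at hε₁
    rw [h, ← sub_le_iff_le_add', le_div_iff₀ hd₁]
    linarith
  · have h : (d - 1) * deltaOf d ε = (d - 1 + d * ε) / (d + 1) := by
      rw [deltaOf, hd₂]
      field_simp
    rw [le_div_iff₀ hd₀] at hε₂
    rw [h, div_le_one (by positivity)]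
    linarith

theorem jamiolkowski_channelT_deltaOf (hd : 1 < d) (ε : ℝ) :
    jamiolkowski (channelT d (deltaOf d ε)) =
      ((1 - 1 / d + ε / 2 : ℝ) : ℂ) • rhoMinus d + ((1 / d - ε / 2 : ℝ) : ℂ) • rhoPlus d := by
  have h₀ : (d : ℂ) ≠ 0 := Nat.cast_ne_zero.mpr (by lia)
  have h₁ : (d : ℂ) + 1 ≠ 0 := Nat.cast_add_one_ne_zero d
  have h₂ : (d : ℂ) - 1 ≠ 0 := sub_ne_zero.mpr (Nat.cast_ne_one.mpr hd.ne')
  rw [jamiolkowski_eq_smul_choi, choi_channelT, rhoMinus, rhoPlus, Fintype.card_fin, deltaOf,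
    show ((d : ℝ) ^ 2 - 1) = (d - 1) * (d + 1) by ring]
  push_cast
  match_scalars <;> field_simp <;> ring

theorem flipExpectation_channelT (hd : d ≠ 0) (δ : ℝ) :
    flipExpectation (channelT d δ) = (1 + δ - δ * d ^ 2) / d := by
  rw [flipExpectation_eq, choi_channelT, sub_mul, Matrix.smul_mul, Matrix.smul_mul, one_mul,
    flipOp_mul_flipOp, trace_sub, trace_smul, trace_smul, trace_flipOp, trace_one,
    Fintype.card_prod, Fintype.card_fin, smul_eq_mul, smul_eq_mul]
  have hd₀ : (d : ℂ) ≠ 0 := Nat.cast_ne_zero.mpr hd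
  push_cast
  field_simp

theorem flipExpectation_channelT_deltaOf (hd : 1 < d) (ε : ℝ) :
    flipExpectation (channelT d (deltaOf d ε)) = ((-1 + 2 / d - ε : ℝ) : ℂ) := by
  have h₁ : (d : ℂ) + 1 ≠ 0 := Nat.cast_add_one_ne_zero d
  have h₂ : (d : ℂ) - 1 ≠ 0 := sub_ne_zero.mpr (Nat.cast_ne_one.mpr hd.ne')
  rw [flipExpectation_channelT (by lia), deltaOf,
    show ((d : ℝ) ^ 2 - 1) = (d - 1) * (d + 1) by ring]
  push_cast
  field_simp
  ring

theorem not_isMixtureOfUnitaries_channelT_deltaOf (hd : 1 < d) (hodd : Odd d) {ε : ℝ}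
    (hε : 0 < ε) : ¬ IsMixtureOfUnitaries (channelT d (deltaOf d ε)) := by
  intro h
  have hbound := le_flipExpectation_of_odd_card (by rwa [Fintype.card_fin]) h
  rw [flipExpectation_channelT_deltaOf hd, Fintype.card_fin] at hbound
  have : (-1 + 2 / d : ℝ) ≤ -1 + 2 / d - ε :=
    Complex.real_le_real.mp (by simpa using hbound)
  linarith

end ChannelT

section Copies

theorem commute_kronecker {m n : Type*} [Fintype m] [Fintype n] {A A' : Matrix m m ℂ}
    {B B' : Matrix n n ℂ} (hA : Commute A A') (hB : Commute B B') :
    Commute (A ⊗ₖ B) (A' ⊗ₖ B') := by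
  rw [commute_iff_eq, ← mul_kronecker_mul, ← mul_kronecker_mul, hA.eq, hB.eq]

variable {n : Type*} [DecidableEq n]

theorem conjTranspose_opF : (opF n)ᴴ = opF n := by
  rw [opF, conjTranspose_smul, conjTranspose_add, conjTranspose_permMatrix,
    conjTranspose_permMatrix, show star (1 / 2 : ℂ) = 1 / 2 by simp]
  rfl

variable [Fintype n]

theorem opF12_eq_flipOp : opF12 n = flipOp (n × n) := by
  rw [opF12, ← permMatrix_mul]
  rfl

/-- Regrouping of the four tensor factors from the order (inputs of both copies) × (outputs of both
copies), in which Choi matrices on a bipartite system are written, to the order (first copy) ×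
(second copy). -/
noncomputable def byCopies :
    Matrix ((n × n) × (n × n)) ((n × n) × (n × n)) ℂ ≃ₐ[ℂ]
      Matrix ((n × n) × (n × n)) ((n × n) × (n × n)) ℂ :=
  reindexAlgEquiv ℂ ℂ (Equiv.prodProdProdComm n n n n)

theorem byCopies_apply (X : Matrix ((n × n) × (n × n)) ((n × n) × (n × n)) ℂ)
    (x y : (n × n) × (n × n)) :
    byCopies X x y = X ((x.1.1, x.2.1), (x.1.2, x.2.2)) ((y.1.1, y.2.1), (y.1.2, y.2.2)) := rfl

theorem trace_byCopies (X : Matrix ((n × n) × (n × n)) ((n × n) × (n × n)) ℂ) :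
    (byCopies X).trace = X.trace :=
  (Equiv.prodProdProdComm n n n n).symm.sum_comp fun x => X x x

theorem byCopies_swapFirst :
    byCopies ((swapFirst n).permMatrix ℂ) = flipOp n ⊗ₖ (1 : Matrix (n × n) (n × n) ℂ) := by
  ext x y
  simp only [byCopies_apply, swapFirst, PEquiv.toMatrix_apply, Equiv.toPEquiv_apply,
    Equiv.coe_fn_mk, Option.mem_def, Option.some.injEq, Prod.ext_iff, kroneckerMap_apply,
    flipOp_apply, Prod.fst_swap, Prod.snd_swap, Matrix.one_apply, mul_ite, mul_one, mul_zero,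
    ← ite_and]
  grind

theorem byCopies_swapSecond :
    byCopies ((swapSecond n).permMatrix ℂ) = (1 : Matrix (n × n) (n × n) ℂ) ⊗ₖ flipOp n := by
  ext x y
  simp only [byCopies_apply, swapSecond, PEquiv.toMatrix_apply, Equiv.toPEquiv_apply,
    Equiv.coe_fn_mk, Option.mem_def, Option.some.injEq, Prod.ext_iff, kroneckerMap_apply,
    flipOp_apply, Prod.fst_swap, Prod.snd_swap, Matrix.one_apply, mul_ite, mul_one, mul_zero,
    ← ite_and]
  grind

theorem byCopies_opF :
    byCopies (opF n) = (1 / 2 : ℂ) • (flipOp n ⊗ₖ (1 : Matrix (n × n) (n × n) ℂ) +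
      (1 : Matrix (n × n) (n × n) ℂ) ⊗ₖ flipOp n) := by
  rw [opF, map_smul, map_add, byCopies_swapFirst, byCopies_swapSecond]

theorem byCopies_opF12 : byCopies (opF12 n) = flipOp n ⊗ₖ flipOp n := by
  rw [opF12, map_mul, byCopies_swapFirst, byCopies_swapSecond, ← mul_kronecker_mul, one_mul,
    mul_one]

theorem byCopies_choi_tensorMap (S T : Matrix n n ℂ →ₗ[ℂ] Matrix n n ℂ) :
    byCopies (choi (tensorMap S T)) = choi S ⊗ₖ choi T := by
  rw [choi_tensorMap]
  rfl

theorem byCopies_kronecker_self (A B : Matrix n n ℂ) :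
    byCopies ((A ⊗ₖ B) ⊗ₖ (A ⊗ₖ B)) = (A ⊗ₖ A) ⊗ₖ (B ⊗ₖ B) := by
  ext x y
  exact mul_mul_mul_comm _ _ _ _

theorem byCopies_flipOp_kronecker_flipOp :
    byCopies (flipOp n ⊗ₖ flipOp n) = flipOp (n × n) := by
  ext x y
  simp only [byCopies_apply, kroneckerMap_apply, flipOp_apply, Prod.swap_prod_mk, Prod.ext_iff,
    mul_ite, mul_one, mul_zero, ← ite_and, Prod.fst_swap, Prod.snd_swap]
  grind

theorem commute_kronecker_self_flipOp (A : Matrix n n ℂ) : Commute (A ⊗ₖ A) (flipOp n) :=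
  (flipOp_mul_kronecker A A).symm

theorem commute_kronecker_self_opF (A B : Matrix n n ℂ) :
    Commute ((A ⊗ₖ B) ⊗ₖ (A ⊗ₖ B)) (opF n) := by
  refine Commute.of_map (f := byCopies) byCopies.injective ?_
  rw [byCopies_kronecker_self, byCopies_opF]
  exact .smul_right (.add_right
    (commute_kronecker (commute_kronecker_self_flipOp A) (.one_right _))
    (commute_kronecker (.one_right _) (commute_kronecker_self_flipOp B))) _

theorem commute_flipOp_kronecker_flipOp_opF : Commute (flipOp n ⊗ₖ flipOp n) (opF n) := by
  refine Commute.of_map (f := byCopies) byCopies.injective ?_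
  rw [byCopies_flipOp_kronecker_flipOp, byCopies_opF]
  refine .smul_right ?_ _
  rw [commute_iff_eq, mul_add, add_mul, flipOp_mul_kronecker, flipOp_mul_kronecker, add_comm]

theorem coords_eq (S : Matrix (n × n) (n × n) ℂ →ₗ[ℂ] Matrix (n × n) (n × n) ℂ) :
    coords S = (1 / (Fintype.card (n × n) : ℂ)) •
      ((choi S * opF n).trace, (choi S * opF12 n).trace) := by
  simp only [coords, jamiolkowski_eq_smul_choi, Matrix.smul_mul, trace_smul, Prod.smul_mk]

theorem isLinearMap_coords : IsLinearMap ℝ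
    (coords : (Matrix (n × n) (n × n) ℂ →ₗ[ℂ] Matrix (n × n) (n × n) ℂ) → ℂ × ℂ) where
  map_add S T := by
    simp only [coords_eq, map_add, add_mul, trace_add, ← smul_add, Prod.mk_add_mk]
  map_smul r S := by
    rw [← algebraMap_smul ℂ r S, ← algebraMap_smul ℂ r]
    simp only [coords_eq, map_smul, Matrix.smul_mul, trace_smul, ← Prod.smul_mk]
    exact smul_comm _ _ _

theorem coords_tensorMap {S T : Matrix n n ℂ →ₗ[ℂ] Matrix n n ℂ} (hS : S 1 = 1) (hT : T 1 = 1) :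
    coords (tensorMap S T) =
      ((flipExpectation S + flipExpectation T) / 2, flipExpectation S * flipExpectation T) := by
  rw [coords_eq, ← trace_byCopies, ← trace_byCopies (_ * opF12 n), map_mul, map_mul,
    byCopies_choi_tensorMap, byCopies_opF, byCopies_opF12, flipExpectation_eq, flipExpectation_eq]
  simp only [Matrix.mul_smul, mul_add, ← mul_kronecker_mul, trace_smul, trace_add, trace_kronecker,
    mul_one, trace_choi, hS, hT, trace_one, Fintype.card_prod, Prod.smul_mk, smul_eq_mul]
  push_cast
  ext <;> field

theorem tensorMap_conjBy (A B : Matrix n n ℂ) :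
    tensorMap (conjBy A) (conjBy B) = conjBy (A ⊗ₖ B) := by
  refine Matrix.ext_linearMap ℂ fun x y => LinearMap.ext_ring ?_
  simp only [LinearMap.comp_apply, singleLinearMap_apply, tensorMap_single, conjBy_apply,
    ← conjTranspose_kronecker, mul_kronecker_mul, single_kronecker_single, mul_one]

end Copies

section Commutant

variable {n : Type*} [DecidableEq n]

/-- The diagonal of the unitary that multiplies the basis vector `m` by `i`. -/
noncomputable def phase (m : n) : n → ℂ := Function.update 1 m Complex.I

theorem phase_mul_phase_injective {a b c d : n}
    (h : ∀ m, phase m a * phase m b = phase m c * phase m d) :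
    (a, b) = (c, d) ∨ (b, a) = (c, d) := by
  have h₁ : Complex.I ≠ 1 := fun h => by simpa using congrArg Complex.re h
  have h₂ : Complex.I * Complex.I ≠ Complex.I := fun h => by simpa using congrArg Complex.im h
  have h₃ : Complex.I * Complex.I ≠ 1 := by norm_num
  have ha := h a
  have hb := h b
  simp only [phase, Function.update_apply, Pi.one_apply] at ha hb
  grind

variable [Fintype n]

theorem diagonal_phase_mem_unitaryGroup (m : n) : diagonal (phase m) ∈ unitaryGroup n ℂ := by
  rw [mem_unitaryGroup_iff, star_eq_conjTranspose, diagonal_conjTranspose, diagonal_mul_diagonal,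
    ← diagonal_one]
  congr 1
  ext a
  by_cases h : a = m <;> simp [phase, h]

theorem permMatrix_mem_unitaryGroup (σ : Equiv.Perm n) : σ.permMatrix ℂ ∈ unitaryGroup n ℂ := by
  rw [mem_unitaryGroup_iff, star_eq_conjTranspose, conjTranspose_permMatrix, ← permMatrix_mul,
    inv_mul_cancel, permMatrix_one]

theorem one_add_smul_allOnes_mem_unitaryGroup [Nonempty n] :
    1 + ((Complex.I - 1) / Fintype.card n : ℂ) • Matrix.of (fun _ _ => 1) ∈ unitaryGroup n ℂ := by
  have hJ : (Matrix.of fun _ _ => 1 : Matrix n n ℂ) * Matrix.of (fun _ _ => 1) =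
      (Fintype.card n : ℂ) • Matrix.of fun _ _ => 1 := by
    ext
    simp [Matrix.mul_apply]
  have hJstar : (Matrix.of fun _ _ => 1 : Matrix n n ℂ)ᴴ = Matrix.of fun _ _ => 1 := by
    ext
    simp
  have hcard : (Fintype.card n : ℂ) ≠ 0 := Nat.cast_ne_zero.mpr Fintype.card_ne_zero
  have hc : (Complex.I - 1) / Fintype.card n + (-Complex.I - 1) / Fintype.card n +
      (Complex.I - 1) / Fintype.card n * ((-Complex.I - 1) / Fintype.card n) *
        (Fintype.card n : ℂ) = 0 := by
    field_simp
    linear_combination -Complex.I_sq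
  rw [mem_unitaryGroup_iff, star_eq_conjTranspose, conjTranspose_add, conjTranspose_one,
    conjTranspose_smul, hJstar, add_mul, mul_add, mul_add, one_mul, one_mul, mul_one,
    smul_mul_smul_comm, hJ, smul_smul, add_assoc, ← add_smul, ← add_smul]
  simp only [star_div₀, star_sub, star_one, star_natCast, Complex.star_def, Complex.conj_I]
  rw [← add_assoc, add_comm ((-Complex.I - 1) / _), hc, zero_smul, add_zero]

variable {X : Matrix (n × n) (n × n) ℂ}

theorem apply_eq_zero_of_commute (hX : ∀ w ∈ unitaryGroup n ℂ, Commute (w ⊗ₖ w) X) {x y : n × n}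
    (h₁ : x ≠ y) (h₂ : x.swap ≠ y) : X x y = 0 := by
  by_contra hne
  have hphase (m : n) : phase m x.1 * phase m x.2 = phase m y.1 * phase m y.2 := by
    have h := congrFun₂ (hX _ (diagonal_phase_mem_unitaryGroup m)).eq x y
    rw [diagonal_kronecker_diagonal, diagonal_mul, mul_diagonal, mul_comm] at h
    exact mul_left_cancel₀ hne h
  exact (phase_mul_phase_injective hphase).elim h₁ h₂

theorem apply_perm_eq_of_commute (hX : ∀ w ∈ unitaryGroup n ℂ, Commute (w ⊗ₖ w) X)
    (σ : Equiv.Perm n) (x y : n × n) :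
    X (σ x.1, σ x.2) (σ y.1, σ y.2) = X x y := by
  have h := congrFun₂ (hX _ (permMatrix_mem_unitaryGroup σ)).eq x (σ y.1, σ y.2)
  simpa [Matrix.mul_apply, Fintype.sum_prod_type, PEquiv.toMatrix_apply] using h

theorem apply_diag_eq_add_of_commute (hX : ∀ w ∈ unitaryGroup n ℂ, Commute (w ⊗ₖ w) X) {a b : n}
    (hab : a ≠ b) : X (a, a) (a, a) = X (a, b) (a, b) + X (a, b) (b, a) := by
  have : Nonempty n := ⟨a⟩
  set c : ℂ := (Complex.I - 1) / Fintype.card n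
  set w : Matrix n n ℂ := 1 + c • Matrix.of fun _ _ => 1 with hw
  have hwab : w a b = c := by simp [hw, hab]
  have hwaa : w a a = 1 + c := by simp [hw]
  have hswap : X (b, a) (a, b) = X (a, b) (b, a) := by
    simpa using apply_perm_eq_of_commute hX (Equiv.swap a b) (a, b) (b, a)
  -- Compare the entries at `(a, a)`, `(a, b)` for a unitary `w` none of whose entries vanishes.
  have h := congrFun₂ (hX w one_add_smul_allOnes_mem_unitaryGroup).eq (a, a) (a, b)
  rw [Matrix.mul_apply, Matrix.mul_apply, Fintype.sum_eq_add (a, b) (b, a) (by grind)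
    fun y hy => by
      rw [apply_eq_zero_of_commute hX hy.1 fun h => hy.2 (Prod.swap_injective h), mul_zero],
    Fintype.sum_eq_single (a, a) fun y hy => by
      rw [apply_eq_zero_of_commute hX hy.symm hy.symm, zero_mul]] at h
  simp only [kroneckerMap_apply, hwab, hwaa, hswap] at h
  have hc : c.im ≠ 0 := by simp [c]
  have hc₀ : c ≠ 0 := fun h => hc (by simp [h])
  have hc₁ : 1 + c ≠ 0 := fun h => hc (by simpa using congrArg Complex.im h)
  apply mul_left_cancel₀ (mul_ne_zero hc₀ hc₁)
  linear_combination -h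

theorem eq_smul_one_add_smul_flipOp_of_commute
    (hX : ∀ w ∈ unitaryGroup n ℂ, Commute (w ⊗ₖ w) X) {i j : n} (hij : i ≠ j) :
    X = X (i, j) (i, j) • 1 + X (i, j) (j, i) • flipOp n := by
  have hperm {a b : n} (hab : a ≠ b) : ∃ σ : Equiv.Perm n, σ i = a ∧ σ j = b :=
    MulAction.is_two_pretransitive_iff.mp (Equiv.Perm.isMultiplyPretransitive n 2) hij hab
  have hid {a b : n} (hab : a ≠ b) : X (a, b) (a, b) = X (i, j) (i, j) := by
    obtain ⟨σ, rfl, rfl⟩ := hperm hab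
    exact apply_perm_eq_of_commute hX σ (i, j) (i, j)
  have hflip {a b : n} (hab : a ≠ b) : X (a, b) (b, a) = X (i, j) (j, i) := by
    obtain ⟨σ, rfl, rfl⟩ := hperm hab
    exact apply_perm_eq_of_commute hX σ (i, j) (j, i)
  have hdiag (a : n) : X (a, a) (a, a) = X (i, j) (i, j) + X (i, j) (j, i) := by
    have : Nontrivial n := ⟨i, j, hij⟩
    obtain ⟨b, hb⟩ := exists_ne a
    rw [apply_diag_eq_add_of_commute hX hb.symm, hid hb.symm, hflip hb.symm]
  ext ⟨a, b⟩ y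
  by_cases h₁ : (a, b) = y
  · subst h₁
    by_cases hab : a = b
    · simp [hab, hdiag, flipOp_apply]
    · simp [hid hab, flipOp_apply, Ne.symm hab]
  · by_cases h₂ : (b, a) = y
    · subst h₂
      simp_all [flipOp_apply]
    · simp [apply_eq_zero_of_commute hX h₁ h₂, h₁, flipOp_apply, h₂]

end Commutant

section PairCommutant

theorem commute_block_of_commute_kronecker_one {m p : Type*} [Fintype m] [Fintype p]
    [DecidableEq p] {A : Matrix m m ℂ} {X : Matrix (m × p) (m × p) ℂ}
    (h : Commute (A ⊗ₖ (1 : Matrix p p ℂ)) X) (c d : p) :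
    Commute A (X.submatrix (·, c) (·, d)) := by
  ext x y
  simpa [Matrix.mul_apply, Fintype.sum_prod_type, one_apply] using congrFun₂ h.eq (x, c) (y, d)

theorem commute_block_of_commute_one_kronecker {m p : Type*} [Fintype m] [Fintype p]
    [DecidableEq m] {B : Matrix p p ℂ} {X : Matrix (m × p) (m × p) ℂ}
    (h : Commute ((1 : Matrix m m ℂ) ⊗ₖ B) X) (x y : m) :
    Commute B (X.submatrix (x, ·) (y, ·)) := by
  ext c d
  simpa [Matrix.mul_apply, Fintype.sum_prod_type, one_apply] using congrFun₂ h.eq (x, c) (y, d)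

variable {n : Type*} [Fintype n] [DecidableEq n] [Nontrivial n]

theorem exists_eq_smul_kronecker_of_commute {X : Matrix ((n × n) × (n × n)) ((n × n) × (n × n)) ℂ}
    (hX : ∀ A ∈ unitaryGroup n ℂ, ∀ B ∈ unitaryGroup n ℂ, Commute ((A ⊗ₖ A) ⊗ₖ (B ⊗ₖ B)) X) :
    ∃ a b c e : ℂ, X = a • 1 + b • ((1 : Matrix (n × n) (n × n) ℂ) ⊗ₖ flipOp n) +
      c • (flipOp n ⊗ₖ (1 : Matrix (n × n) (n × n) ℂ)) + e • (flipOp n ⊗ₖ flipOp n) := by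
  obtain ⟨i, j, hij⟩ := exists_pair_ne n
  have hleft (c d : n × n) := eq_smul_one_add_smul_flipOp_of_commute (fun A hA =>
    commute_block_of_commute_kronecker_one
      (by simpa only [one_kronecker_one] using hX A hA 1 (one_mem _)) c d) hij
  have hright (x y : n × n) := eq_smul_one_add_smul_flipOp_of_commute (fun B hB =>
    commute_block_of_commute_one_kronecker
      (by simpa only [one_kronecker_one] using hX 1 (one_mem _) B hB) x y) hij
  refine ⟨X ((i, j), i, j) ((i, j), i, j), X ((i, j), i, j) ((i, j), j, i),
    X ((i, j), i, j) ((j, i), i, j), X ((i, j), i, j) ((j, i), j, i), ?_⟩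
  ext ⟨x, c⟩ ⟨y, d⟩
  have h := congrFun₂ (hleft c d) x y
  have h₁ := congrFun₂ (hright (i, j) (i, j)) c d
  have h₂ := congrFun₂ (hright (i, j) (j, i)) c d
  simp only [submatrix_apply, Matrix.add_apply, Matrix.smul_apply, smul_eq_mul] at h h₁ h₂
  rw [h, h₁, h₂, ← one_kronecker_one (m := n × n) (n := n × n)]
  simp only [Matrix.add_apply, Matrix.smul_apply, kroneckerMap_apply, smul_eq_mul]
  ring

variable (n) in
/-- The operators on two copies that commute with all `(A ⊗ B) ⊗ (A ⊗ B)`, `A` and `B` unitary, and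
with the exchange of the copies. -/
noncomputable def flipSpan : Submodule ℂ (Matrix ((n × n) × (n × n)) ((n × n) × (n × n)) ℂ) :=
  Submodule.span ℂ {1, opF n, opF12 n}

theorem mem_flipSpan_of_commute {Z : Matrix ((n × n) × (n × n)) ((n × n) × (n × n)) ℂ}
    (hZ : ∀ A ∈ unitaryGroup n ℂ, ∀ B ∈ unitaryGroup n ℂ, Commute ((A ⊗ₖ B) ⊗ₖ (A ⊗ₖ B)) Z)
    (hswap : Commute (flipOp n ⊗ₖ flipOp n) Z) : Z ∈ flipSpan n := by
  obtain ⟨a, b, c, e, habce⟩ := exists_eq_smul_kronecker_of_commute (X := byCopies Z)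
    fun A hA B hB => by simpa only [byCopies_kronecker_self] using (hZ A hA B hB).map byCopies
  have hsymm : b • ((1 : Matrix (n × n) (n × n) ℂ) ⊗ₖ flipOp n) +
      c • (flipOp n ⊗ₖ (1 : Matrix (n × n) (n × n) ℂ)) =
      b • (flipOp n ⊗ₖ (1 : Matrix (n × n) (n × n) ℂ)) +
        c • ((1 : Matrix (n × n) (n × n) ℂ) ⊗ₖ flipOp n) := by
    have h := (hswap.map byCopies).eq
    rw [byCopies_flipOp_kronecker_flipOp, habce, mul_add, mul_add, mul_add] at h
    simp only [mul_smul_comm, flipOp_mul_kronecker, mul_one] at h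
    have hcancel := (IsUnit.of_mul_eq_one _ (flipOp_mul_flipOp (n := n × n))).mul_right_cancel
      (a := a • 1 + b • (flipOp n ⊗ₖ 1) + c • (1 ⊗ₖ flipOp n) + e • (flipOp n ⊗ₖ flipOp n))
      (.trans (by simp only [add_mul, smul_mul_assoc, one_mul]) h)
    linear_combination (norm := module) -hcancel
  have hbyCopies : byCopies Z = byCopies (a • 1 + (b + c) • opF n + e • opF12 n) := by
    rw [map_add, map_add, map_smul, map_smul, map_smul, map_one, byCopies_opF, byCopies_opF12,
      habce]
    linear_combination (norm := module) (1 / 2 : ℂ) • hsymm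
  rw [byCopies.injective hbyCopies]
  exact Submodule.mem_span_triple.mpr ⟨a, b + c, e, rfl⟩

end PairCommutant

section Twirl

variable {n : Type*} [Fintype n] [DecidableEq n]

variable (n) in
/-- The Choi matrices of the mixtures of unitaries. -/
def mixtureChoi : Set (Matrix (n × n) (n × n) ℂ) :=
  convexHull ℝ ((fun U => vecMulVec (vec U) (star (vec U))) '' unitaryGroup n ℂ)

theorem choi_mem_mixtureChoi_iff {S : Matrix n n ℂ →ₗ[ℂ] Matrix n n ℂ} :
    choi S ∈ mixtureChoi n ↔ IsMixtureOfUnitaries S := by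
  have himage : mixtureChoi n = choi '' convexHull ℝ (unitaryChannels n) := by
    rw [mixtureChoi, ← LinearMap.coe_restrictScalars ℝ choi, LinearMap.image_convexHull,
      unitaryChannels, Set.image_image]
    simp only [LinearMap.coe_restrictScalars, choi_conjBy]
  rw [himage, choi_injective.mem_set_image, isMixtureOfUnitaries_iff_mem_convexHull]

theorem isCompact_mixtureChoi : IsCompact (mixtureChoi n) :=
  isCompact_convexHull (isCompact_unitaryGroup.image (by unfold vec; fun_prop))

theorem trace_eq_card_of_mem_mixtureChoi {X : Matrix (n × n) (n × n) ℂ} (hX : X ∈ mixtureChoi n) :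
    X.trace = (Fintype.card n : ℂ) := by
  refine convexHull_min (t := {X | X.trace = (Fintype.card n : ℂ)}) ?_ ?_ hX
  · rintro _ ⟨U, hU, rfl⟩
    have h := trace_choi (conjBy U)
    rwa [choi_conjBy, conjBy_apply, mul_one, ← star_eq_conjTranspose, mem_unitaryGroup_iff.mp hU,
      trace_one] at h
  · exact (convex_singleton (Fintype.card n : ℂ)).linear_preimage
      ((traceLinearMap (n × n) ℂ ℂ).restrictScalars ℝ)

theorem conj_kronecker_self_mem_mixtureChoi {W : Matrix n n ℂ} (hW : W ∈ unitaryGroup n ℂ)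
    {X : Matrix (n × n) (n × n) ℂ} (hX : X ∈ mixtureChoi n) :
    (W ⊗ₖ W) * X * (W ⊗ₖ W)ᴴ ∈ mixtureChoi n := by
  have hconv : Convex ℝ {X | (W ⊗ₖ W) * X * (W ⊗ₖ W)ᴴ ∈ mixtureChoi n} :=
    (convex_convexHull ℝ _).linear_preimage ((conjBy (W ⊗ₖ W)).restrictScalars ℝ)
  refine convexHull_min (Set.image_subset_iff.mpr fun U hU => ?_) hconv hX
  refine subset_convexHull ℝ _ ⟨W * U * Wᵀ, mul_mem (mul_mem hW hU)
    (transpose_mem_unitaryGroup_iff.mpr hW), ?_⟩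
  simp only [← kronecker_mulVec_vec]
  rw [mul_vecMulVec, vecMulVec_mul, star_mulVec]

theorem eq_of_mem_flipSpan {X Y : Matrix ((n × n) × (n × n)) ((n × n) × (n × n)) ℂ}
    (hX : X ∈ flipSpan n) (hY : Y ∈ flipSpan n) (htrace : X.trace = Y.trace)
    (hF : (X * opF n).trace = (Y * opF n).trace)
    (hF12 : (X * opF12 n).trace = (Y * opF12 n).trace) : X = Y := by
  obtain ⟨a, b, c, hΔ⟩ := Submodule.mem_span_triple.mp ((flipSpan n).sub_mem hX hY)
  rw [← sub_eq_zero, ← trace_mul_conjTranspose_self_eq_zero_iff]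
  nth_rw 2 [← hΔ]
  rw [opF12_eq_flipOp] at hF12 ⊢
  simp only [conjTranspose_add, conjTranspose_smul, conjTranspose_one, conjTranspose_opF,
    conjTranspose_flipOp, mul_add, Matrix.mul_smul, mul_one, trace_add, trace_smul, sub_mul,
    trace_sub, htrace, hF, hF12, sub_self, add_zero]

theorem trace_unitary_conj_mul {R O : Matrix n n ℂ} (hR : R ∈ unitaryGroup n ℂ)
    (hRO : Commute R O) (Y : Matrix n n ℂ) : (R * Y * Rᴴ * O).trace = (Y * O).trace := by
  calc (R * Y * Rᴴ * O).trace = (Y * (Rᴴ * (O * R))).trace := by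
        rw [Matrix.mul_assoc, Matrix.mul_assoc, trace_mul_comm, Matrix.mul_assoc, Matrix.mul_assoc]
    _ = (Y * O).trace := by
        rw [← hRO.eq, ← Matrix.mul_assoc Rᴴ, ← star_eq_conjTranspose, mem_unitaryGroup_iff'.mp hR,
          Matrix.one_mul]

theorem commute_of_unitary_conj_eq_self {R Z : Matrix n n ℂ} (hR : R ∈ unitaryGroup n ℂ)
    (h : R * Z * Rᴴ = Z) : Commute R Z := by
  rw [commute_iff_eq]
  nth_rw 2 [← h]
  rw [Matrix.mul_assoc _ Rᴴ, ← star_eq_conjTranspose, mem_unitaryGroup_iff'.mp hR, Matrix.mul_one]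

theorem exists_mem_mixtureChoi_mem_flipSpan [Nontrivial n]
    {X : Matrix ((n × n) × (n × n)) ((n × n) × (n × n)) ℂ} (hX : X ∈ mixtureChoi (n × n)) :
    ∃ Z ∈ mixtureChoi (n × n), Z ∈ flipSpan n ∧ (Z * opF n).trace = (X * opF n).trace ∧
      (Z * opF12 n).trace = (X * opF12 n).trace := by
  let fiber (O : Matrix ((n × n) × (n × n)) ((n × n) × (n × n)) ℂ) :
      Set (Matrix ((n × n) × (n × n)) ((n × n) × (n × n)) ℂ) :=
    {Z | (Z * O).trace = (X * O).trace}
  have hclosed (O) : IsClosed (fiber O) := isClosed_eq (by fun_prop) continuous_const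
  have hconv (O) : Convex ℝ (fiber O) :=
    (convex_singleton (X * O).trace).linear_preimage
      ((traceLinearMap _ ℂ ℂ ∘ₗ LinearMap.mulRight ℂ O).restrictScalars ℝ)
  obtain ⟨Z, ⟨⟨hZ, hZF⟩, hZF12⟩, hfix⟩ := exists_mem_forall_unitary_conj_eq_self
    ((isCompact_mixtureChoi.inter_right (hclosed (opF n))).inter_right (hclosed (opF12 n)))
    (((convex_convexHull ℝ _).inter (hconv _)).inter (hconv _)) ⟨X, ⟨hX, rfl⟩, rfl⟩
  have hcomm {W : Matrix (n × n) (n × n) ℂ} (hW : W ∈ unitaryGroup (n × n) ℂ)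
      (hF : Commute (W ⊗ₖ W) (opF n)) : Commute (W ⊗ₖ W) Z := by
    have hF12 : Commute (W ⊗ₖ W) (opF12 n) := by
      rw [opF12_eq_flipOp]
      exact commute_kronecker_self_flipOp W
    have hWW : W ⊗ₖ W ∈ unitaryGroup _ ℂ := kronecker_mem_unitary hW hW
    have h := hfix _ hWW fun Y hY =>
      ⟨⟨conj_kronecker_self_mem_mixtureChoi hW hY.1.1,
        (trace_unitary_conj_mul hWW hF Y).trans hY.1.2⟩,
        (trace_unitary_conj_mul hWW hF12 Y).trans hY.2⟩
    exact commute_of_unitary_conj_eq_self hWW h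
  exact ⟨Z, hZ, mem_flipSpan_of_commute (fun A hA B hB => hcomm (kronecker_mem_unitary hA hB)
    (commute_kronecker_self_opF A B))
    (hcomm flipOp_mem_unitaryGroup commute_flipOp_kronecker_flipOp_opF), hZF, hZF12⟩

theorem IsMixtureOfUnitaries.of_coords_eq [Nontrivial n]
    {S S' : Matrix (n × n) (n × n) ℂ →ₗ[ℂ] Matrix (n × n) (n × n) ℂ}
    (hS' : IsMixtureOfUnitaries S') (hS : S 1 = 1) (hspan : choi S ∈ flipSpan n)
    (hcoords : coords S = coords S') : IsMixtureOfUnitaries S := by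
  obtain ⟨Z, hZ, hZspan, hF, hF12⟩ :=
    exists_mem_mixtureChoi_mem_flipSpan (choi_mem_mixtureChoi_iff.mpr hS')
  have hcard : (1 / (Fintype.card (n × n) : ℂ)) ≠ 0 := by simp
  rw [coords_eq, coords_eq, (smul_right_injective _ hcard).eq_iff, Prod.mk.injEq] at hcoords
  rw [← choi_mem_mixtureChoi_iff]
  convert hZ
  refine eq_of_mem_flipSpan hspan hZspan ?_ (hcoords.1.trans hF.symm) (hcoords.2.trans hF12.symm)
  rw [trace_choi, hS, trace_one, trace_eq_card_of_mem_mixtureChoi hZ]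

end Twirl

section MaxEntangledProj

variable {n : Type*} [DecidableEq n] [Fintype n]

variable (n) in
/-- The projection `|Ω⟩⟨Ω|` onto the maximally entangled vector. -/
noncomputable def maxEntangledProj : Matrix (n × n) (n × n) ℂ :=
  vecMulVec (maxEntangled n) (star (maxEntangled n))

theorem maxEntangledProj_apply (x y : n × n) : maxEntangledProj n x y =
    if x.1 = x.2 ∧ y.1 = y.2 then 1 / (Fintype.card n : ℂ) else 0 := by
  have hsq : ((1 / √(Fintype.card n) : ℝ) : ℂ) * ((1 / √(Fintype.card n) : ℝ) : ℂ) =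
      1 / (Fintype.card n : ℂ) := by
    rw [← Complex.ofReal_mul, ← sq, div_pow, Real.sq_sqrt (Nat.cast_nonneg _)]
    push_cast
    ring
  simp only [maxEntangledProj, vecMulVec_apply, maxEntangled, Pi.star_apply, apply_ite star,
    Complex.star_def, Complex.conj_ofReal, star_zero, ite_zero_mul_ite_zero, hsq]

theorem transpose_maxEntangledProj : (maxEntangledProj n)ᵀ = maxEntangledProj n := by
  ext x y
  simp only [transpose_apply, maxEntangledProj_apply, and_comm]

theorem conjTranspose_maxEntangledProj : (maxEntangledProj n)ᴴ = maxEntangledProj n := by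
  rw [maxEntangledProj, conjTranspose_vecMulVec, star_star]

theorem flipOp_mul_maxEntangledProj : flipOp n * maxEntangledProj n = maxEntangledProj n := by
  ext x y
  simp only [flipOp_mul_apply, maxEntangledProj_apply, Prod.fst_swap, Prod.snd_swap, eq_comm]

theorem maxEntangledProj_mul_flipOp : maxEntangledProj n * flipOp n = maxEntangledProj n := by
  ext x y
  simp only [mul_flipOp_apply, maxEntangledProj_apply, Prod.fst_swap, Prod.snd_swap, eq_comm]

theorem maxEntangledProj_mul_apply {m : Type*} (X : Matrix (n × n) m ℂ) (x : n × n) (y : m) :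
    (maxEntangledProj n * X) x y =
      if x.1 = x.2 then 1 / (Fintype.card n : ℂ) * ∑ j, X (j, j) y else 0 := by
  simp only [Matrix.mul_apply, maxEntangledProj_apply, Fintype.sum_prod_type, ite_and, ite_mul,
    zero_mul, Finset.sum_ite_irrel, Finset.sum_const_zero, Finset.sum_ite_eq, Finset.mem_univ,
    if_true, Finset.mul_sum]

variable [Nonempty n]

theorem trace_maxEntangledProj : (maxEntangledProj n).trace = 1 := by
  simp [trace, maxEntangledProj_apply, Fintype.sum_prod_type]

theorem maxEntangledProj_mul_self :
    maxEntangledProj n * maxEntangledProj n = maxEntangledProj n := by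
  ext x y
  simp [maxEntangledProj_mul_apply, maxEntangledProj_apply, ite_and]

end MaxEntangledProj

section PartialTranspose

variable {n : Type*}

/-- The partial transpose of an operator on a bipartite system, with respect to the first tensor
factor. -/
def partialTranspose (X : Matrix (n × n) (n × n) ℂ) : Matrix (n × n) (n × n) ℂ :=
  Matrix.of fun x y => X (y.1, x.2) (x.1, y.2)

theorem partialTranspose_transpose (X : Matrix (n × n) (n × n) ℂ) :
    partialTranspose Xᵀ = (partialTranspose X)ᵀ := rfl

/-- The symmetric part of a matrix under transposition; the coordinates of `conjBy U` depend on it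
through its partial transpose. -/
noncomputable def symmPart {m : Type*} (A : Matrix m m ℂ) : Matrix m m ℂ := (1 / 2 : ℂ) • (A + Aᵀ)

variable [Fintype n]

theorem trace_conjTranspose_mul_partialTranspose_symmPart (U : Matrix (n × n) (n × n) ℂ) :
    (Uᴴ * partialTranspose (symmPart U)).trace =
      ((symmPart U)ᴴ * partialTranspose (symmPart U)).trace := by
  have hsymm : (partialTranspose (symmPart U))ᵀ = partialTranspose (symmPart U) := by
    rw [← partialTranspose_transpose, symmPart, transpose_smul, transpose_add,
      transpose_transpose, add_comm]
  have htranspose : ((Uᵀ)ᴴ * partialTranspose (symmPart U)).trace =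
      (Uᴴ * partialTranspose (symmPart U)).trace := by
    rw [← trace_transpose, transpose_mul, hsymm, trace_mul_comm]
    rfl
  have hconj : (symmPart U)ᴴ = (1 / 2 : ℂ) • (Uᴴ + (Uᵀ)ᴴ) := by
    rw [symmPart, conjTranspose_smul, conjTranspose_add, show star (1 / 2 : ℂ) = 1 / 2 by simp]
  rw [hconj, Matrix.smul_mul, Matrix.add_mul, trace_smul, trace_add, htranspose, smul_eq_mul]
  ring

variable [DecidableEq n]

theorem opF_mulVec_vec (U : Matrix (n × n) (n × n) ℂ) :
    opF n *ᵥ vec U = vec (partialTranspose (symmPart U)) := by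
  rw [opF, smul_mulVec, add_mulVec, permMatrix_mulVec, permMatrix_mulVec]
  rfl

theorem coords_conjBy (U : Matrix (n × n) (n × n) ℂ) :
    coords (conjBy U) = (1 / (Fintype.card (n × n) : ℂ)) •
      (((symmPart U)ᴴ * partialTranspose (symmPart U)).trace, (Uᴴ * Uᵀ).trace) := by
  rw [coords_eq, choi_conjBy, opF12_eq_flipOp, trace_vecMulVec_vec_mul_flipOp, trace_mul_comm,
    mul_vecMulVec, trace_vecMulVec, opF_mulVec_vec, dotProduct_comm, star_vec_dotProduct_vec,
    trace_conjTranspose_mul_partialTranspose_symmPart]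

theorem partialTranspose_flipOp :
    partialTranspose (flipOp n) = (Fintype.card n : ℂ) • maxEntangledProj n := by
  ext x y
  have : Nonempty n := ⟨x.1⟩
  simp only [partialTranspose, of_apply, flipOp_apply, Prod.swap_prod_mk, Prod.mk.injEq,
    Matrix.smul_apply, maxEntangledProj_apply, smul_eq_mul, mul_ite, mul_zero, mul_one_div]
  rw [div_self (by simp)]
  grind

theorem partialTranspose_maxEntangledProj :
    partialTranspose (maxEntangledProj n) = (1 / (Fintype.card n : ℂ)) • flipOp n := by
  ext x y
  simp only [partialTranspose, of_apply, flipOp_apply, Matrix.smul_apply, maxEntangledProj_apply,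
    smul_eq_mul, mul_ite, mul_zero, mul_one, Prod.ext_iff, Prod.fst_swap, Prod.snd_swap]
  grind

end PartialTranspose

theorem ofReal_one_div_sqrt_sq (k : ℕ) : ((1 / √k : ℝ) : ℂ) ^ 2 = 1 / k := by
  rw [← Complex.ofReal_pow, div_pow, Real.sq_sqrt k.cast_nonneg, one_pow]
  push_cast
  rfl

theorem sqrt_three_div_eight : √(3 / 8) = 3 / 2 * (1 / √6) := by
  rw [Real.sqrt_eq_iff_eq_sq (by norm_num) (by positivity), mul_pow, div_pow 1,
    Real.sq_sqrt (by norm_num)]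
  norm_num

theorem map_star_matV :
    matV.map star = ((2 : ℂ) • maxEntangledProj (Fin 3) - flipOp (Fin 3)) * matV := by
  have hc : 1 / (2 * √2) = (1 / 2 : ℝ) * (1 / √2 : ℝ) := by ring
  have hb : 1 / (2 * √6) = (1 / 2 : ℝ) * (1 / √6 : ℝ) := by ring
  ext ⟨i, j⟩ k
  rw [Matrix.sub_mul, Matrix.smul_mul, Matrix.sub_apply, Matrix.smul_apply,
    maxEntangledProj_mul_apply, flipOp_mul_apply, map_apply]
  fin_cases i <;> fin_cases j <;> fin_cases k <;>
    simp [Fin.sum_univ_succ, finProdFinEquiv, matV, hc, hb] <;> ring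

set_option maxHeartbeats 1000000 in
-- the identity is verified on all 81 entries
theorem matV_mul_transpose :
    matV * matVᵀ = (2 : ℂ) • maxEntangledProj (Fin 3) - flipOp (Fin 3) := by
  have ha : ((1 / √2 : ℝ) : ℂ) ^ 2 = 1 / 2 := mod_cast ofReal_one_div_sqrt_sq 2
  have hg : ((1 / √6 : ℝ) : ℂ) ^ 2 = 1 / 6 := mod_cast ofReal_one_div_sqrt_sq 6
  have he : ((1 / √3 : ℝ) : ℂ) ^ 2 = 1 / 3 := mod_cast ofReal_one_div_sqrt_sq 3
  have hc : 1 / (2 * √2) = (1 / 2 : ℝ) * (1 / √2 : ℝ) := by ring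
  have hb : 1 / (2 * √6) = (1 / 2 : ℝ) * (1 / √6 : ℝ) := by ring
  simp only [matV, hc, hb, sqrt_three_div_eight, Complex.ofReal_mul]
  generalize ((1 / √2 : ℝ) : ℂ) = a at *
  generalize ((1 / √6 : ℝ) : ℂ) = g at *
  generalize ((1 / √3 : ℝ) : ℂ) = e at *
  have hI := Complex.I_sq
  ext ⟨i, j⟩ ⟨k, l⟩
  rw [Matrix.sub_apply, Matrix.smul_apply, maxEntangledProj_apply, flipOp_apply, Matrix.mul_apply]
  fin_cases i <;> fin_cases j <;> fin_cases k <;> fin_cases l <;>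
    simp [Fin.sum_univ_succ, finProdFinEquiv] <;> grind

theorem matV_mul_conjTranspose : matV * matVᴴ = 1 := by
  have hmap : matVᴴ = matVᵀ * ((2 : ℂ) • maxEntangledProj (Fin 3) - flipOp (Fin 3)) := by
    have h := congrArg transpose map_star_matV
    rwa [transpose_mul, transpose_sub, transpose_smul, transpose_maxEntangledProj,
      transpose_flipOp] at h
  rw [hmap, ← Matrix.mul_assoc, matV_mul_transpose]
  simp only [sub_mul, mul_sub, Matrix.smul_mul, Matrix.mul_smul, maxEntangledProj_mul_self,
    maxEntangledProj_mul_flipOp, flipOp_mul_maxEntangledProj, flipOp_mul_flipOp]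
  module

theorem conjTranspose_matV_mul : matVᴴ * matV = 1 :=
  (mul_eq_one_comm_of_equiv finProdFinEquiv).mp matV_mul_conjTranspose

theorem matV_mulVec_single_last : matV *ᵥ Pi.single (Fin.last 8) 1 = maxEntangled (Fin 3) := by
  ext ⟨i, j⟩
  rw [mulVec_single_one]
  fin_cases i <;> fin_cases j <;> simp [matV, maxEntangled, finProdFinEquiv]

theorem conjTranspose_matD (θ : ℝ) : (matD θ)ᴴ = (matD θ)ᵀ := by
  ext i j
  fin_cases i <;> fin_cases j <;> simp [matD, -Complex.ofReal_cos, -Complex.ofReal_sin]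

theorem matD_mul_transpose (θ : ℝ) : matD θ * (matD θ)ᵀ = 1 := by
  have h := Complex.cos_sq_add_sin_sq θ
  ext i j
  fin_cases i <;> fin_cases j <;> simp [matD, Matrix.mul_apply, Fin.sum_univ_succ] <;> grind

theorem matD_add_transpose (θ : ℝ) : matD θ + (matD θ)ᵀ = (2 * Real.cos θ : ℂ) • 1 +
    (2 * (1 - Real.cos θ) : ℂ) •
      vecMulVec (Pi.single (Fin.last 8) 1) (Pi.single (Fin.last 8) 1) := by
  ext i j
  fin_cases i <;> fin_cases j <;> simp [matD, vecMulVec_apply] <;> ring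

theorem trace_matD_mul_self (θ : ℝ) :
    (matD θ * matD θ).trace = ((16 * Real.cos θ ^ 2 - 7 : ℝ) : ℂ) := by
  have htrace : (matD θ * matD θ).trace = 8 * (Complex.cos θ ^ 2 - Complex.sin θ ^ 2) + 1 := by
    simp [matD, trace, Fin.sum_univ_succ]
    ring
  rw [htrace, Complex.sin_sq]
  push_cast
  ring

theorem transpose_matV_mul_conjTranspose : matVᵀ * (matVᵀ)ᴴ = 1 := by
  rw [show (matVᵀ)ᴴ = (matVᴴ)ᵀ from rfl, ← transpose_mul, conjTranspose_matV_mul, transpose_one]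

theorem matU_mem_unitaryGroup (θ : ℝ) : matU θ ∈ unitaryGroup (Fin 3 × Fin 3) ℂ := by
  have hD : matD θ * (matD θ)ᴴ = 1 := by rw [conjTranspose_matD, matD_mul_transpose]
  rw [mem_unitaryGroup_iff, star_eq_conjTranspose]
  calc matU θ * (matU θ)ᴴ
      = matV * (matD θ * (matVᵀ * (matVᵀ)ᴴ) * (matD θ)ᴴ) * matVᴴ := by
        simp only [matU, conjTranspose_mul, Matrix.mul_assoc]
    _ = 1 := by
        rw [transpose_matV_mul_conjTranspose, Matrix.mul_one, hD, Matrix.mul_one,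
          matV_mul_conjTranspose]

theorem transpose_matU (θ : ℝ) : (matU θ)ᵀ = matV * (matD θ)ᵀ * matVᵀ := by
  simp only [matU, transpose_mul, transpose_transpose, Matrix.mul_assoc]

theorem symmPart_matU (θ : ℝ) : symmPart (matU θ) =
    (1 + Real.cos θ : ℂ) • maxEntangledProj (Fin 3) - (Real.cos θ : ℂ) • flipOp (Fin 3) := by
  have hstar : star (maxEntangled (Fin 3)) = maxEntangled (Fin 3) := by
    ext x
    simp only [maxEntangled, Pi.star_apply, apply_ite star, Complex.star_def, Complex.conj_ofReal,
      star_zero]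
  let v : Fin 9 → ℂ := Pi.single (Fin.last 8) 1
  have hlast : matV * vecMulVec v v * matVᵀ = maxEntangledProj (Fin 3) := by
    rw [mul_vecMulVec, vecMulVec_mul, vecMul_transpose, matV_mulVec_single_last, maxEntangledProj,
      hstar]
  rw [symmPart, transpose_matU, matU, ← Matrix.add_mul, ← Matrix.mul_add, matD_add_transpose,
    Matrix.mul_add, Matrix.add_mul, Matrix.mul_smul, Matrix.mul_smul, Matrix.smul_mul,
    Matrix.smul_mul, hlast, Matrix.mul_one, matV_mul_transpose]
  module

theorem trace_conjTranspose_matU_mul_transpose (θ : ℝ) :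
    ((matU θ)ᴴ * (matU θ)ᵀ).trace = ((16 * Real.cos θ ^ 2 - 7 : ℝ) : ℂ) := by
  calc ((matU θ)ᴴ * (matU θ)ᵀ).trace
      = ((matVᵀ)ᴴ * ((matD θ)ᵀ * (matVᴴ * matV) * (matD θ)ᵀ * matVᵀ)).trace := by
        rw [transpose_matU]
        simp only [matU, conjTranspose_mul, Matrix.mul_assoc, conjTranspose_matD]
    _ = ((matD θ)ᵀ * (matD θ)ᵀ * (matVᵀ * (matVᵀ)ᴴ)).trace := by
        rw [conjTranspose_matV_mul, Matrix.mul_one, trace_mul_comm, Matrix.mul_assoc]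
    _ = (matD θ * matD θ).trace := by
        rw [transpose_matV_mul_conjTranspose, Matrix.mul_one, ← transpose_mul, trace_transpose]
    _ = _ := trace_matD_mul_self θ

theorem trace_mul_partialTranspose_smul_sub_smul {n : Type*} [Fintype n] [DecidableEq n]
    [Nonempty n] (a b : ℂ) :
    ((a • maxEntangledProj n - b • flipOp n) *
      partialTranspose (a • maxEntangledProj n - b • flipOp n)).trace =
        a ^ 2 / Fintype.card n - 2 * a * b * Fintype.card n + b ^ 2 * Fintype.card n := by
  have hlin : partialTranspose (a • maxEntangledProj n - b • flipOp n) =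
      a • partialTranspose (maxEntangledProj n) - b • partialTranspose (flipOp n) := rfl
  have hn : (Fintype.card n : ℂ) ≠ 0 := by simp
  simp only [hlin, partialTranspose_maxEntangledProj, partialTranspose_flipOp, sub_mul, mul_sub,
    Matrix.smul_mul, Matrix.mul_smul, maxEntangledProj_mul_flipOp, flipOp_mul_maxEntangledProj,
    maxEntangledProj_mul_self, flipOp_mul_flipOp, trace_sub, trace_smul, trace_maxEntangledProj,
    trace_one, Fintype.card_prod, smul_eq_mul]
  push_cast
  field

theorem coords_conjBy_matU (θ : ℝ) : coords (conjBy (matU θ)) =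
    (((1 / 9 * (-(8 / 3) * (Real.cos θ + 1) ^ 2 + 3) : ℝ) : ℂ),
      ((1 / 9 * (16 * Real.cos θ ^ 2 - 7) : ℝ) : ℂ)) := by
  have hM : (symmPart (matU θ))ᴴ = symmPart (matU θ) := by
    simp only [symmPart_matU, conjTranspose_sub, conjTranspose_smul, conjTranspose_flipOp,
      conjTranspose_maxEntangledProj, star_add, star_one, Complex.star_def, Complex.conj_ofReal]
  rw [coords_conjBy, trace_conjTranspose_matU_mul_transpose, hM, symmPart_matU,
    trace_mul_partialTranspose_smul_sub_smul, Fintype.card_prod, Fintype.card_fin, Prod.smul_mk]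
  push_cast
  simp only [smul_eq_mul]
  congr 1
  ring

section Region

theorem sq_mem_of_convex {C : Set (ℝ × ℝ)} (hC : Convex ℝ C) {x₁ x₂ x y : ℝ}
    (h₁ : (x₁, x₁ ^ 2) ∈ C) (h₂ : (x₂, x₂ ^ 2) ∈ C) (h : (x, y) ∈ C) (hx : x ∈ Set.Icc x₁ x₂)
    (hy : y ≤ x ^ 2) : (x, x ^ 2) ∈ C := by
  have hvert : Convex ℝ {t | (x, t) ∈ C} :=
    hC.affine_preimage ((AffineMap.const ℝ ℝ x).prod (AffineMap.id ℝ ℝ))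
  rw [← segment_eq_Icc (hx.1.trans hx.2)] at hx
  obtain ⟨a, b, ha, hb, hab, hxab⟩ := hx
  have hchord : (x, a * x₁ ^ 2 + b * x₂ ^ 2) ∈ C := by
    simpa [← hxab] using hC h₁ h₂ ha hb hab
  have hle : x ^ 2 ≤ a * x₁ ^ 2 + b * x₂ ^ 2 := by
    simpa [← hxab] using (even_two.convexOn_pow (𝕜 := ℝ)).2 trivial trivial ha hb hab
  exact hvert.ordConnected.out h hchord ⟨hy, hle⟩

/-- The pairs of real numbers that occur as coordinates of mixtures of unitary channels on two
copies of a system. -/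
def mixtureRegion (n : Type*) [Fintype n] [DecidableEq n] : Set (ℝ × ℝ) :=
  {p | ∃ S : Matrix (n × n) (n × n) ℂ →ₗ[ℂ] Matrix (n × n) (n × n) ℂ,
    IsMixtureOfUnitaries S ∧ coords S = ((p.1 : ℂ), (p.2 : ℂ))}

variable {n : Type*} [Fintype n] [DecidableEq n]

theorem convex_mixtureRegion : Convex ℝ (mixtureRegion n) := by
  have hpreimage : mixtureRegion n =
      (Complex.ofRealLI.toLinearMap.prodMap Complex.ofRealLI.toLinearMap) ⁻¹'
        (coords '' convexHull ℝ (unitaryChannels (n × n))) := by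
    ext p
    simp only [mixtureRegion, isMixtureOfUnitaries_iff_mem_convexHull]
    rfl
  rw [hpreimage]
  exact ((convex_convexHull ℝ _).is_linear_image isLinearMap_coords).linear_preimage _

theorem mem_mixtureRegion_of_mem_unitaryGroup {U : Matrix (n × n) (n × n) ℂ}
    (hU : U ∈ unitaryGroup (n × n) ℂ) {p : ℝ × ℝ}
    (hp : coords (conjBy U) = ((p.1 : ℂ), (p.2 : ℂ))) : p ∈ mixtureRegion n :=
  ⟨_, isMixtureOfUnitaries_iff_mem_convexHull.2 (subset_convexHull ℝ _ ⟨U, hU, rfl⟩), hp⟩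

theorem sq_mem_mixtureRegion_of_flipExpectation {U : Matrix n n ℂ} (hU : U ∈ unitaryGroup n ℂ)
    {x : ℝ} (hx : flipExpectation (conjBy U) = x) : (x, x ^ 2) ∈ mixtureRegion n := by
  have hunital : conjBy U 1 = 1 := by
    rw [conjBy_apply, mul_one]
    exact mem_unitaryGroup_iff.1 hU
  refine mem_mixtureRegion_of_mem_unitaryGroup (kronecker_mem_unitary hU hU) ?_
  rw [← tensorMap_conjBy, coords_tensorMap hunital hunital, hx]
  push_cast
  ext <;> ring

/-- The rotation by the angle `φ` in the plane of the first two basis vectors of `ℂ³`. -/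
noncomputable def planeRotation (φ : ℝ) : Matrix (Fin 3) (Fin 3) ℂ :=
  !![(Real.cos φ : ℂ), -(Real.sin φ : ℂ), 0;
     (Real.sin φ : ℂ), (Real.cos φ : ℂ), 0;
     0, 0, 1]

theorem conjTranspose_planeRotation (φ : ℝ) : (planeRotation φ)ᴴ = (planeRotation φ)ᵀ := by
  ext i j
  fin_cases i <;> fin_cases j <;> simp [planeRotation, -Complex.ofReal_cos, -Complex.ofReal_sin]

theorem planeRotation_mem_unitaryGroup (φ : ℝ) : planeRotation φ ∈ unitaryGroup (Fin 3) ℂ := by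
  have hcs : (Real.cos φ : ℂ) * Real.cos φ + Real.sin φ * Real.sin φ = 1 := by
    rw [← sq, ← sq]
    exact_mod_cast Real.cos_sq_add_sin_sq φ
  have hsc : (Real.sin φ : ℂ) * Real.sin φ + Real.cos φ * Real.cos φ = 1 := by
    rw [add_comm, hcs]
  rw [mem_unitaryGroup_iff, star_eq_conjTranspose, conjTranspose_planeRotation]
  ext i j
  fin_cases i <;> fin_cases j <;>
    simp [planeRotation, Matrix.mul_apply, Fin.sum_univ_three, hcs, hsc, mul_comm,
      -Complex.ofReal_cos, -Complex.ofReal_sin]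

theorem flipExpectation_conjBy_planeRotation (φ : ℝ) :
    flipExpectation (conjBy (planeRotation φ)) = (((1 + 2 * Real.cos (2 * φ)) / 3 : ℝ) : ℂ) := by
  have h : (Real.sin φ : ℂ) ^ 2 = 1 - (Real.cos φ : ℂ) ^ 2 := by
    exact_mod_cast Real.sin_sq φ
  rw [flipExpectation_conjBy, conjTranspose_planeRotation, Real.cos_two_mul]
  simp [planeRotation, Matrix.trace_fin_three, -Complex.ofReal_cos, -Complex.ofReal_sin]
  linear_combination (-2 / 3) * h

theorem sq_mem_mixtureRegion {x : ℝ} (hx : x ∈ Set.Icc (-(1 / 3)) 1) :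
    (x, x ^ 2) ∈ mixtureRegion (Fin 3) := by
  refine sq_mem_mixtureRegion_of_flipExpectation
    (planeRotation_mem_unitaryGroup (Real.arccos ((3 * x - 1) / 2) / 2)) ?_
  rw [flipExpectation_conjBy_planeRotation, mul_div_cancel₀ _ two_ne_zero,
    Real.cos_arccos (by linarith [hx.1]) (by linarith [hx.2])]
  congr 1
  ring

end Region

section Threshold

theorem exists_angle_cos_eq {c : ℝ} (hc : c ∈ Set.Icc 0 1) :
    ∃ θ ∈ Set.Icc 0 (Real.pi / 2), Real.cos θ = c :=
  ⟨Real.arccos c, ⟨Real.arccos_nonneg c, Real.arccos_le_pi_div_two.2 hc.1⟩,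
    Real.cos_arccos (by linarith [hc.1]) hc.2⟩

/-- The value of the curve parameter `w = (2 / 3) (cos θ + 1)` at which the coordinates of the
conjugations by `matU θ` meet the parabola of the coordinates `(x, x ^ 2)`. -/
noncomputable def wStar : ℝ := √3 - (√6 - √2) / 2

theorem sqrt_two_bounds : 1.41421 < √2 ∧ √2 < 1.41422 :=
  ⟨Real.lt_sqrt_of_sq_lt (by norm_num), (Real.sqrt_lt' (by norm_num)).2 (by norm_num)⟩

theorem sqrt_three_bounds : 1.73205 < √3 ∧ √3 < 1.73206 :=
  ⟨Real.lt_sqrt_of_sq_lt (by norm_num), (Real.sqrt_lt' (by norm_num)).2 (by norm_num)⟩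

theorem sqrt_six_bounds : 2.44948 < √6 ∧ √6 < 2.4495 :=
  ⟨Real.lt_sqrt_of_sq_lt (by norm_num), (Real.sqrt_lt' (by norm_num)).2 (by norm_num)⟩

theorem abs_epsStar_sub_lt : |epsStar - 1 / √10| < 1 / 1000 := by
  obtain ⟨h2, h2'⟩ := sqrt_two_bounds
  obtain ⟨h3, h3'⟩ := sqrt_three_bounds
  obtain ⟨h6, h6'⟩ := sqrt_six_bounds
  have h10 : 3.1622 < √10 := Real.lt_sqrt_of_sq_lt (by norm_num)
  have h10' : √10 < 3.1623 := (Real.sqrt_lt' (by norm_num)).2 (by norm_num)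
  have hlower : 0.3162 < 1 / √10 := by
    rw [lt_div_iff₀ (by positivity)]
    linarith
  have hupper : 1 / √10 < 0.3163 := by
    rw [div_lt_iff₀ (by positivity)]
    linarith
  rw [abs_lt, epsStar]
  constructor <;> linarith

theorem wStar_mem_Icc : wStar ∈ Set.Icc 1 (4 / 3) := by
  obtain ⟨h2, h2'⟩ := sqrt_two_bounds
  obtain ⟨h3, h3'⟩ := sqrt_three_bounds
  obtain ⟨h6, h6'⟩ := sqrt_six_bounds
  rw [wStar]
  constructor <;> linarith

theorem sqrt_six_eq : √6 = √2 * √3 := by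
  rw [← Real.sqrt_mul zero_le_two]
  norm_num

theorem wStar_sq : wStar ^ 2 = 1 + 3 / 2 * epsStar := by
  have h2 : √2 ^ 2 = (2 : ℝ) := Real.sq_sqrt (by norm_num)
  have h3 : √3 ^ 2 = (3 : ℝ) := Real.sq_sqrt (by norm_num)
  rw [wStar, epsStar, sqrt_six_eq]
  linear_combination (1 / 4 + √3 ^ 2 / 4 - √3 / 2) * h2 + (3 / 2 - √2) * h3

theorem quartic_eq_mul (w : ℝ) :
    w ^ 4 - 10 * w ^ 2 + 12 * w - 2 =
      (w ^ 2 + 2 * √3 * w + (1 - √3)) * ((wStar - w) * (√3 + (√6 - √2) / 2 - w)) := by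
  have h2 : √2 ^ 2 = (2 : ℝ) := Real.sq_sqrt (by norm_num)
  have h3 : √3 ^ 2 = (3 : ℝ) := Real.sq_sqrt (by norm_num)
  have hroots : (wStar - w) * (√3 + (√6 - √2) / 2 - w) = w ^ 2 - 2 * √3 * w + (1 + √3) := by
    rw [wStar, sqrt_six_eq]
    linear_combination (√3 / 2 - 1 / 4 - √3 ^ 2 / 4) * h2 + (1 / 2) * h3
  rw [hroots]
  linear_combination (4 * w ^ 2 + 1 - 4 * w) * h3

theorem quartic_wStar : wStar ^ 4 - 10 * wStar ^ 2 + 12 * wStar - 2 = 0 := by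
  rw [quartic_eq_mul, sub_self, zero_mul, mul_zero]

theorem quartic_nonneg {w : ℝ} (hw : w ∈ Set.Icc 1 wStar) :
    0 ≤ w ^ 4 - 10 * w ^ 2 + 12 * w - 2 := by
  have h62 : √2 ≤ √6 := Real.sqrt_le_sqrt (by norm_num)
  have h3 : 0 ≤ √3 * (w - 1) := mul_nonneg (Real.sqrt_nonneg 3) (sub_nonneg.2 hw.1)
  have hwStar := wStar.eq_def
  rw [quartic_eq_mul]
  refine mul_nonneg ?_ (mul_nonneg ?_ ?_)
  · nlinarith [Real.sqrt_nonneg 3]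
  · linarith [hw.2]
  · linarith [hw.2]

/-- The coordinates of the conjugation by `matU θ` at the parameter `w = (2 / 3) (cos θ + 1)`,
whose distance from the parabola is `x ^ 2 - y = (4 / 9) (w ^ 4 - 10 w ^ 2 + 12 w - 2)`. -/
noncomputable def unitaryCurve (w : ℝ) : ℝ × ℝ :=
  ((1 - 2 * w ^ 2) / 3, 4 * w ^ 2 - 16 / 3 * w + 1)

theorem sq_unitaryCurve_fst_sub_snd (w : ℝ) :
    (unitaryCurve w).1 ^ 2 - (unitaryCurve w).2 =
      4 / 9 * (w ^ 4 - 10 * w ^ 2 + 12 * w - 2) := by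
  rw [unitaryCurve]
  ring

theorem unitaryCurve_wStar :
    unitaryCurve wStar = (-1 + 2 / 3 - epsStar, (-1 + 2 / 3 - epsStar) ^ 2) := by
  have hfst : (unitaryCurve wStar).1 = -1 + 2 / 3 - epsStar := by
    rw [unitaryCurve, wStar_sq]
    ring
  have hsnd : (unitaryCurve wStar).2 = (-1 + 2 / 3 - epsStar) ^ 2 := by
    linarith [sq_unitaryCurve_fst_sub_snd wStar, quartic_wStar, congr_arg (· ^ 2) hfst]
  exact Prod.ext hfst hsnd

theorem exists_coords_conjBy_matU_eq {w : ℝ} (hw : w ∈ Set.Icc (2 / 3) (4 / 3)) :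
    ∃ θ ∈ Set.Icc 0 (Real.pi / 2), coords (conjBy (matU θ)) =
      (((unitaryCurve w).1 : ℂ), ((unitaryCurve w).2 : ℂ)) := by
  obtain ⟨θ, hθ, hcos⟩ := exists_angle_cos_eq (c := 3 / 2 * w - 1)
    ⟨by linarith [hw.1], by linarith [hw.2]⟩
  refine ⟨θ, hθ, ?_⟩
  rw [coords_conjBy_matU, hcos]
  simp only [unitaryCurve]
  congr 2 <;> ring

theorem unitaryCurve_mem_mixtureRegion {w : ℝ} (hw : w ∈ Set.Icc (2 / 3) (4 / 3)) :
    unitaryCurve w ∈ mixtureRegion (Fin 3) := by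
  obtain ⟨θ, -, hθ⟩ := exists_coords_conjBy_matU_eq hw
  exact mem_mixtureRegion_of_mem_unitaryGroup (matU_mem_unitaryGroup θ) hθ

theorem parabola_mem_mixtureRegion {ε : ℝ} (hε : ε ∈ Set.Icc (-(4 / 3)) epsStar) :
    (-1 + 2 / 3 - ε, (-1 + 2 / 3 - ε) ^ 2) ∈ mixtureRegion (Fin 3) := by
  rcases le_or_gt ε 0 with hε₀ | hε₀
  · exact sq_mem_mixtureRegion ⟨by linarith, by linarith [hε.1]⟩
  have hw_sq : √(1 + 3 / 2 * ε) ^ 2 = 1 + 3 / 2 * ε := Real.sq_sqrt (by linarith)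
  have hw : √(1 + 3 / 2 * ε) ∈ Set.Icc 1 wStar := by
    refine ⟨Real.one_le_sqrt.2 (by linarith), Real.sqrt_le_iff.2 ⟨?_, ?_⟩⟩
    · exact zero_le_one.trans wStar_mem_Icc.1
    · linarith [wStar_sq, hε.2]
  set w := √(1 + 3 / 2 * ε)
  have hfst : (unitaryCurve w).1 = -1 + 2 / 3 - ε := by
    rw [unitaryCurve, hw_sq]
    ring
  have hmeet := unitaryCurve_mem_mixtureRegion (Set.Icc_subset_Icc_left (by norm_num) wStar_mem_Icc)
  rw [unitaryCurve_wStar] at hmeet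
  have hcurve : (-1 + 2 / 3 - ε, (unitaryCurve w).2) ∈ mixtureRegion (Fin 3) := by
    rw [← hfst]
    exact unitaryCurve_mem_mixtureRegion
      ⟨by linarith [hw.1], by linarith [hw.2, wStar_mem_Icc.2]⟩
  have hbelow : (unitaryCurve w).2 ≤ (-1 + 2 / 3 - ε) ^ 2 := by
    rw [← hfst]
    linarith [sq_unitaryCurve_fst_sub_snd w, quartic_nonneg hw]
  exact sq_mem_of_convex convex_mixtureRegion hmeet
    (sq_mem_mixtureRegion ⟨by norm_num, le_rfl⟩) hcurve
    ⟨by linarith [hε.2], by linarith⟩ hbelow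

end Threshold

section TwoCopiesOfChannelT

variable {d : ℕ}

theorem tensorMap_channelT_one (hd : d ≠ 0) (δ : ℝ) :
    tensorMap (channelT d δ) (channelT d δ) 1 = 1 := by
  rw [← one_kronecker_one, tensorMap_kronecker, channelT_one hd]

theorem choi_tensorMap_channelT_mem_flipSpan (δ : ℝ) :
    choi (tensorMap (channelT d δ) (channelT d δ)) ∈ flipSpan (Fin d) := by
  refine Submodule.mem_span_triple.2
    ⟨((1 + δ) / d) ^ 2, -(2 * ((1 + δ) / d) * δ), δ ^ 2, byCopies.injective ?_⟩
  rw [byCopies_choi_tensorMap, choi_channelT, map_add, map_add, map_smul, map_smul, map_smul,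
    map_one, byCopies_opF, byCopies_opF12, ← one_kronecker_one]
  simp only [sub_eq_add_neg, ← neg_smul, add_kronecker, kronecker_add, smul_kronecker,
     kronecker_smul]
  module

theorem coords_tensorMap_channelT_deltaOf (hd : 1 < d) (ε : ℝ) :
    coords (tensorMap (channelT d (deltaOf d ε)) (channelT d (deltaOf d ε))) =
      (((-1 + 2 / d - ε : ℝ) : ℂ), (((-1 + 2 / d - ε) ^ 2 : ℝ) : ℂ)) := by
  have hunital := channelT_one (d := d) (by lia) (deltaOf d ε)
  rw [coords_tensorMap hunital hunital, flipExpectation_channelT_deltaOf hd, add_self_div_two,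
    Complex.ofReal_pow, sq]

theorem isMixtureOfUnitaries_tensorMap_channelT_deltaOf (hd : 1 < d) {ε : ℝ}
    (h : (-1 + 2 / d - ε, (-1 + 2 / d - ε) ^ 2) ∈ mixtureRegion (Fin d)) :
    IsMixtureOfUnitaries (tensorMap (channelT d (deltaOf d ε)) (channelT d (deltaOf d ε))) := by
  obtain ⟨S, hS, hcoords⟩ := h
  have : Nontrivial (Fin d) := Fin.nontrivial_iff_two_le.2 hd
  refine .of_coords_eq hS (tensorMap_channelT_one (by lia) _)
    (choi_tensorMap_channelT_mem_flipSpan _) ?_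
  rw [hcoords, coords_tensorMap_channelT_deltaOf hd]

end TwoCopiesOfChannelT

end TwoCopies

theorem mainTheorem6 :
    -- the family of unital channels and its parametrization
    (∀ ε ∈ Set.Icc (-(4 / 3) : ℝ) (2 / 3),
      TwoCopies.IsUnitalChannel (TwoCopies.channelT 3 (TwoCopies.deltaOf 3 ε)) ∧
      TwoCopies.jamiolkowski (TwoCopies.channelT 3 (TwoCopies.deltaOf 3 ε)) =
        ((1 - 1 / 3 + ε / 2 : ℝ) : ℂ) • TwoCopies.rhoMinus 3 +
          ((1 / 3 - ε / 2 : ℝ) : ℂ) • TwoCopies.rhoPlus 3 ∧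
      (TwoCopies.jamiolkowski (TwoCopies.channelT 3 (TwoCopies.deltaOf 3 ε)) *
        TwoCopies.flipOp (Fin 3)).trace = ((-1 + 2 / 3 - ε : ℝ) : ℂ)) ∧
    -- a single copy is not a mixture of unitary channels
    (∀ ε ∈ Set.Ioc (0 : ℝ) (2 / 3),
      ¬ TwoCopies.IsMixtureOfUnitaries (TwoCopies.channelT 3 (TwoCopies.deltaOf 3 ε))) ∧
    -- the explicit unitary matrices and their coordinates
    (∀ θ ∈ Set.Icc (0 : ℝ) (Real.pi / 2),
      TwoCopies.matU θ ∈ Matrix.unitaryGroup (Fin 3 × Fin 3) ℂ ∧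
      TwoCopies.coords (TwoCopies.conjBy (TwoCopies.matU θ)) =
        (((1 / 9 * (-(8 / 3) * (Real.cos θ + 1) ^ 2 + 3) : ℝ) : ℂ),
          ((1 / 9 * (16 * Real.cos θ ^ 2 - 7) : ℝ) : ℂ))) ∧
    -- the coordinates of two copies, and the threshold as the point where they meet the curve
    (∀ ε ∈ Set.Icc (-(4 / 3) : ℝ) (2 / 3),
      TwoCopies.coords
          (TwoCopies.tensorMap (TwoCopies.channelT 3 (TwoCopies.deltaOf 3 ε))
            (TwoCopies.channelT 3 (TwoCopies.deltaOf 3 ε))) =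
        (((-1 + 2 / 3 - ε : ℝ) : ℂ), (((-1 + 2 / 3 - ε) ^ 2 : ℝ) : ℂ))) ∧
    (∃ θ ∈ Set.Icc (0 : ℝ) (Real.pi / 2),
      TwoCopies.coords (TwoCopies.conjBy (TwoCopies.matU θ)) =
        TwoCopies.coords
          (TwoCopies.tensorMap (TwoCopies.channelT 3 (TwoCopies.deltaOf 3 TwoCopies.epsStar))
            (TwoCopies.channelT 3 (TwoCopies.deltaOf 3 TwoCopies.epsStar)))) ∧
    -- two copies are a mixture of unitary channels up to the threshold
    (∀ ε ∈ Set.Icc (-(4 / 3) : ℝ) TwoCopies.epsStar,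
      TwoCopies.IsMixtureOfUnitaries
        (TwoCopies.tensorMap (TwoCopies.channelT 3 (TwoCopies.deltaOf 3 ε))
          (TwoCopies.channelT 3 (TwoCopies.deltaOf 3 ε)))) ∧
    |TwoCopies.epsStar - 1 / √10| < 1 / 1000 := by
  have hcoords (ε : ℝ) := TwoCopies.coords_tensorMap_channelT_deltaOf (d := 3) (by decide) ε
  refine ⟨fun ε hε => ⟨?_, ?_, ?_⟩, fun ε hε => ?_,
    fun θ _ => ⟨TwoCopies.matU_mem_unitaryGroup θ, TwoCopies.coords_conjBy_matU θ⟩,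
    fun ε _ => hcoords ε, ?_, fun ε hε => ?_, TwoCopies.abs_epsStar_sub_lt⟩
  · exact TwoCopies.isUnitalChannel_channelT_deltaOf (by decide)
      (le_trans (by norm_num) hε.1) hε.2
  · exact TwoCopies.jamiolkowski_channelT_deltaOf (by decide) ε
  · exact TwoCopies.flipExpectation_channelT_deltaOf (by decide) ε
  · exact TwoCopies.not_isMixtureOfUnitaries_channelT_deltaOf (by decide) (by decide) hε.1
  · obtain ⟨θ, hθ, hmeet⟩ := TwoCopies.exists_coords_conjBy_matU_eq
      (Set.Icc_subset_Icc_left (by norm_num) TwoCopies.wStar_mem_Icc)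
    exact ⟨θ, hθ, by rw [hmeet, hcoords, TwoCopies.unitaryCurve_wStar]; rfl⟩
  · exact TwoCopies.isMixtureOfUnitaries_tensorMap_channelT_deltaOf (by decide)
      (TwoCopies.parabola_mem_mixtureRegion hε)
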